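/- Let $M$ and $B$ be smooth manifolds (finite-dimensional, without boundary, Hausdorff, second countable) and let $f\colon B\to M$ be a smooth map. Let $L\subset TM\oplus T^*M$ be a Dirac structure on $M$, i.e. a smooth subbundle whose fibres are maximal isotropic for the pairing $\langle (X,\xi),(X',\xi')\rangle=\xi(X')+\xi'(X)$ and whose space of smooth sections is closed under the Courant bracket $$[(X,\xi),(X',\xi')]=([X,X'],\ \mathcal L_X\xi'-\iota_{X'}\mathrm d\xi).$$ Consider the pullback $$f^!L=\{(a,X)\in f^*L\oplus TB : \mathrm{pr}_{TM}(a)=f_*X\}=f^*L\times_{TM}TB,$$ with anchor the projection $(a,X)\mapsto X$ to $TB$, and the family of subspaces of $TB\oplus T^*B$ $$\mathfrak B L=\{(X,f^*\eta) : (f_*X,\eta)\in L\}.$$ Assume that $f^!L$ is smooth, meaning that the fibres of $f^!L\to B$ have constant rank. Then: 1. $\mathfrak B L$ is a Dirac structure on $B$ (in particular a smooth subbundle of $TB\oplus T^*B$). 2. $\mathfrak B L$ and $f^!L$ induce the same singular foliation on $B$: $$\mathrm{pr}_{TB}\big(\Gamma_c(\mathfrak B L)\big)=\mathrm{pr}_{TB}\big(\Gamma_c(f^!L)\big),$$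 where $\Gamma_c$ denotes compactly supported smooth sections, and this set is a singular foliation, i.e. a $C^\infty(B)$-submodule of the compactly supported vector fields on $B$ that is locally finitely generated and closed under the Lie bracket. -/

import Mathlib

open scoped Manifold ContDiff

noncomputable section

namespace DiracPullback

section Single

variable {E : Type*} [NormedAddCommGroup E] [NormedSpace ℝ E]
  {M : Type*} [TopologicalSpace M] [ChartedSpace E M]

/-- The tangent space `T_x M` of a manifold `M` modelled on the vector space `E`. -/
abbrev Tan (E : Type*) [NormedAddCommGroup E] [NormedSpace ℝ E]
    {M : Type*} [TopologicalSpace M] [ChartedSpace E M] (x : M) : Type _ :=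
  TangentSpace 𝓘(ℝ, E) x

/-- The cotangent space `T*_x M`, written as a fibre of Mathlib's bundle of homomorphisms from the
tangent bundle to the trivial line bundle. -/
abbrev Cotan (E : Type*) [NormedAddCommGroup E] [NormedSpace ℝ E]
    {M : Type*} [TopologicalSpace M] [ChartedSpace E M] (x : M) : Type _ :=
  TangentSpace 𝓘(ℝ, E) x →L[ℝ] Bundle.Trivial M ℝ x

/-- The fibre `T_x M ⊕ T*_x M` of the generalized tangent bundle. -/
abbrev GenTan (E : Type*) [NormedAddCommGroup E] [NormedSpace ℝ E]
    {M : Type*} [TopologicalSpace M] [ChartedSpace E M] (x : M) : Type _ :=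
  Tan E x × Cotan E x

/-- The value of a covector on a vector, as a real number. -/
def evalCovector {x : M} (ξ : Cotan E x) (v : Tan E x) : ℝ := ξ v

/-- The vector field `X` is smooth on `U`, as a section of the tangent bundle. -/
def SmoothVectorFieldOn [IsManifold 𝓘(ℝ, E) ∞ M] (X : ∀ x : M, Tan E x) (U : Set M) : Prop :=
  ContMDiffOn 𝓘(ℝ, E) (𝓘(ℝ, E).prod 𝓘(ℝ, E)) ∞
    (fun x => (⟨x, X x⟩ : TangentBundle 𝓘(ℝ, E) M)) U

/-- The one-form `ξ` is smooth on `U`, as a section of the cotangent bundle. -/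
def SmoothOneFormOn [IsManifold 𝓘(ℝ, E) ∞ M] (ξ : ∀ x : M, Cotan E x) (U : Set M) : Prop :=
  ContMDiffOn 𝓘(ℝ, E) (𝓘(ℝ, E).prod 𝓘(ℝ, E →L[ℝ] ℝ)) ∞
    (fun x => (⟨x, ξ x⟩ : Bundle.TotalSpace (E →L[ℝ] ℝ) (fun y : M => Cotan E y))) U

/-- A section of `TM ⊕ T*M` that is smooth on `U`. -/
def SmoothGenSectionOn [IsManifold 𝓘(ℝ, E) ∞ M] (σ : ∀ x : M, GenTan E x) (U : Set M) : Prop :=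
  SmoothVectorFieldOn (fun x => (σ x).1) U ∧ SmoothOneFormOn (fun x => (σ x).2) U

/-- The canonical symmetric pairing `⟨(X, ξ), (Y, η)⟩ = ξ(Y) + η(X)` on `T_x M ⊕ T*_x M`. -/
def pairing {x : M} (a b : GenTan E x) : ℝ :=
  evalCovector a.2 b.1 + evalCovector b.2 a.1

/-- Isotropic subspaces of `T_x M ⊕ T*_x M`. -/
def IsIsotropic {x : M} (V : Submodule ℝ (GenTan E x)) : Prop :=
  ∀ a ∈ V, ∀ b ∈ V, pairing a b = 0

/-- A family of subspaces of the fibres of `TM ⊕ T*M` is a smooth subbundle if near every point it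
is spanned by a smooth local frame. -/
def IsSmoothSubbundle [IsManifold 𝓘(ℝ, E) ∞ M] (L : ∀ x : M, Submodule ℝ (GenTan E x)) : Prop :=
  ∀ x₀ : M, ∃ U : Set M, IsOpen U ∧ x₀ ∈ U ∧ ∃ (r : ℕ) (s : Fin r → ∀ x : M, GenTan E x),
    (∀ i, SmoothGenSectionOn (s i) U) ∧
    ∀ x ∈ U, LinearIndependent ℝ (fun i => s i x) ∧
      Submodule.span ℝ (Set.range fun i => s i x) = L x

/-- The one-form `ξ` read in the preferred chart `φ` around `x₀`, i.e. `(φ⁻¹)^* ξ`. -/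
def oneFormInChart (ξ : ∀ x : M, Cotan E x) (x₀ : M) (e : E) : E →L[ℝ] ℝ :=
  (ξ ((extChartAt 𝓘(ℝ, E) x₀).symm e)).comp
    (mfderiv 𝓘(ℝ, E) 𝓘(ℝ, E) (extChartAt 𝓘(ℝ, E) x₀).symm e)

/-- The contraction `ι_v dξ` at `x` of the exterior derivative of a one-form with `v ∈ T_x M`.
In the preferred chart `φ` at `x`, with `A` the derivative at `φ(x)` of the coordinate expression
of `ξ`, it is the covector `w ↦ A(v)(w) - A(w)(v)`, where `v`, `w` are read in the chart by `dφ`. -/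
def contractD (ξ : ∀ x : M, Cotan E x) (x : M) (v : Tan E x) : Cotan E x :=
  let A : E →L[ℝ] E →L[ℝ] ℝ :=
    fderiv ℝ (oneFormInChart ξ x) (extChartAt 𝓘(ℝ, E) x x)
  let dφ : Tan E x →L[ℝ] E := mfderiv 𝓘(ℝ, E) 𝓘(ℝ, E) (extChartAt 𝓘(ℝ, E) x) x
  (A (dφ v) - A.flip (dφ v)).comp dφ

/-- The Lie derivative `L_X ξ = d(ξ(X)) + ι_X dξ` of a one-form. -/
def lieDerivative (X : ∀ x : M, Tan E x) (ξ : ∀ x : M, Cotan E x) (x : M) : Cotan E x :=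
  let dξX : Cotan E x := mfderiv 𝓘(ℝ, E) 𝓘(ℝ, ℝ) (fun y => evalCovector (ξ y) (X y)) x
  dξX + contractD ξ x (X x)

/-- The Courant bracket `[(X, ξ), (X', ξ')] = ([X, X'], L_X ξ' - ι_{X'} dξ)`. -/
def courantBracket (σ τ : ∀ x : M, GenTan E x) (x : M) : GenTan E x :=
  (VectorField.mlieBracket 𝓘(ℝ, E) (fun y => (σ y).1) (fun y => (τ y).1) x,
    lieDerivative (fun y => (σ y).1) (fun y => (τ y).2) x
      - contractD (fun y => (σ y).2) x (τ x).1)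

/-- Global smooth sections of a family `L` of subspaces of the fibres of `TM ⊕ T*M`. -/
def IsSmoothSection [IsManifold 𝓘(ℝ, E) ∞ M] (L : ∀ x : M, Submodule ℝ (GenTan E x)) (σ : ∀ x : M, GenTan E x) : Prop :=
  SmoothGenSectionOn σ Set.univ ∧ ∀ x, σ x ∈ L x

/-- Dirac structures: smooth subbundles of `TM ⊕ T*M` with maximal isotropic fibres, whose space
of smooth sections is closed under the Courant bracket. -/
structure IsDirac [IsManifold 𝓘(ℝ, E) ∞ M] (L : ∀ x : M, Submodule ℝ (GenTan E x)) : Prop where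
  smooth : IsSmoothSubbundle L
  maximal_isotropic : ∀ x, Maximal IsIsotropic (L x)
  involutive : ∀ σ τ : ∀ x : M, GenTan E x, IsSmoothSection L σ → IsSmoothSection L τ →
    ∀ x, courantBracket σ τ x ∈ L x

/-- The family `L`, with anchor the projection to `TM`, induces the set
`pr_{TM}(Γ_c(L))` of compactly supported vector fields. -/
def diracFoliation [IsManifold 𝓘(ℝ, E) ∞ M] (L : ∀ x : M, Submodule ℝ (GenTan E x)) : Set (∀ x : M, Tan E x) :=
  {X | ∃ σ : ∀ x : M, GenTan E x, IsSmoothSection L σ ∧ IsCompact (closure {x | σ x ≠ 0}) ∧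
    ∀ x, X x = (σ x).1}

/-- Singular foliations: `C^∞(M)`-submodules of the compactly supported smooth vector fields that
are involutive and locally finitely generated. The last condition says that around every point
there are an open set `U` and smooth vector fields `Y₁, …, Y_k` on `U` such that the elements of
`F` with support in `U` are exactly the combinations `∑ hᵢ Yᵢ` with `hᵢ ∈ C_c^∞(U)`. -/
structure IsSingularFoliation [IsManifold 𝓘(ℝ, E) ∞ M] (F : Set (∀ x : M, Tan E x)) : Prop where
  smooth : ∀ X ∈ F, SmoothVectorFieldOn X Set.univ
  compact_support : ∀ X ∈ F, IsCompact (closure {x | X x ≠ 0})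
  zero_mem : (fun _ => 0) ∈ F
  add_mem : ∀ X ∈ F, ∀ Y ∈ F, (fun x => X x + Y x) ∈ F
  smul_mem : ∀ h : M → ℝ, ContMDiff 𝓘(ℝ, E) 𝓘(ℝ, ℝ) ∞ h → ∀ X ∈ F, (fun x => h x • X x) ∈ F
  locally_finitely_generated : ∀ x₀ : M, ∃ U : Set M, IsOpen U ∧ x₀ ∈ U ∧
    ∃ (k : ℕ) (Y : Fin k → ∀ x : M, Tan E x), (∀ i, SmoothVectorFieldOn (Y i) U) ∧
      ∀ X : ∀ x : M, Tan E x, (X ∈ F ∧ closure {x | X x ≠ 0} ⊆ U) ↔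
        ∃ h : Fin k → M → ℝ,
          (∀ i, ContMDiff 𝓘(ℝ, E) 𝓘(ℝ, ℝ) ∞ (h i) ∧ HasCompactSupport (h i) ∧
            tsupport (h i) ⊆ U) ∧
          ∀ x, X x = ∑ i, h i x • Y i x
  involutive : ∀ X ∈ F, ∀ Y ∈ F, (fun x => VectorField.mlieBracket 𝓘(ℝ, E) X Y x) ∈ F

end Single

section Pullback

variable {E : Type*} [NormedAddCommGroup E] [NormedSpace ℝ E]
  {M : Type*} [TopologicalSpace M] [ChartedSpace E M]
  {E' : Type*} [NormedAddCommGroup E'] [NormedSpace ℝ E']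
  {B : Type*} [TopologicalSpace B] [ChartedSpace E' B]

/-- The differential `f_* : T_x B → T_{f(x)} M`. -/
abbrev pushforward (f : B → M) (x : B) : Tan E' x →L[ℝ] Tan E (f x) :=
  mfderiv 𝓘(ℝ, E') 𝓘(ℝ, E) f x

/-- The fibre at `x` of `f^! L = f^* L ×_{TM} TB`, a subspace of
`(T_{f(x)} M ⊕ T*_{f(x)} M) ⊕ T_x B`: the pairs `(a, X)` with `a ∈ L_{f(x)}` and
`pr_{TM} a = f_* X`. -/
def algebroidPullback (f : B → M) (L : ∀ y : M, Submodule ℝ (GenTan E y)) (x : B) :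
    Submodule ℝ (GenTan E (f x) × Tan E' x) where
  carrier := {p | p.1 ∈ L (f x) ∧ p.1.1 = pushforward f x p.2}
  zero_mem' := ⟨(L (f x)).zero_mem, by simp⟩
  add_mem' := by
    rintro p q ⟨hp, hp'⟩ ⟨hq, hq'⟩
    exact ⟨(L (f x)).add_mem hp hq, by simp [hp', hq']⟩
  smul_mem' := by
    rintro c p ⟨hp, hp'⟩
    exact ⟨(L (f x)).smul_mem c hp, by simp [hp']⟩

/-- `f^! L` is smooth: the fibres of `f^! L → B` have constant rank. -/
def AlgebroidPullbackSmooth (f : B → M) (L : ∀ y : M, Submodule ℝ (GenTan E y)) : Prop :=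
  ∃ r : ℕ, ∀ x : B, Module.finrank ℝ (algebroidPullback (E' := E') f L x) = r

/-- Smooth sections of `f^! L`: sections of `f^*(TM ⊕ T*M) ⊕ TB` with values in `f^! L`, all of
whose components are smooth. A section of a bundle pulled back along `f` is a map to its
total space that covers `f`. -/
def IsSmoothSectionAlgebroidPullback [IsManifold 𝓘(ℝ, E) ∞ M] [IsManifold 𝓘(ℝ, E') ∞ B]
    (f : B → M) (L : ∀ y : M, Submodule ℝ (GenTan E y))
    (σ : ∀ x : B, GenTan E (f x) × Tan E' x) : Prop :=
  ContMDiff 𝓘(ℝ, E') (𝓘(ℝ, E).prod 𝓘(ℝ, E)) ∞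
      (fun x => (⟨f x, (σ x).1.1⟩ : TangentBundle 𝓘(ℝ, E) M)) ∧
    ContMDiff 𝓘(ℝ, E') (𝓘(ℝ, E).prod 𝓘(ℝ, E →L[ℝ] ℝ)) ∞
      (fun x => (⟨f x, (σ x).1.2⟩ :
        Bundle.TotalSpace (E →L[ℝ] ℝ) (fun y : M => Cotan E y))) ∧
    SmoothVectorFieldOn (fun x => (σ x).2) Set.univ ∧
    ∀ x, σ x ∈ algebroidPullback f L x

/-- The image of the compactly supported smooth sections of `f^! L` under its anchor, the
projection to `TB`. -/
def algebroidPullbackFoliation [IsManifold 𝓘(ℝ, E) ∞ M] [IsManifold 𝓘(ℝ, E') ∞ B]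
    (f : B → M) (L : ∀ y : M, Submodule ℝ (GenTan E y)) :
    Set (∀ x : B, Tan E' x) :=
  {X | ∃ σ : ∀ x : B, GenTan E (f x) × Tan E' x, IsSmoothSectionAlgebroidPullback f L σ ∧
    IsCompact (closure {x | σ x ≠ 0}) ∧ ∀ x, X x = (σ x).2}

/-- The pullback `𝔅L = {(X, f^* η) : (f_* X, η) ∈ L}`, as a family of subspaces of the fibres
of `TB ⊕ T*B`. -/
def diracPullback (f : B → M) (L : ∀ y : M, Submodule ℝ (GenTan E y)) (x : B) :
    Submodule ℝ (GenTan E' x) where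
  carrier := {p | ∃ η : Cotan E (f x), (pushforward f x p.1, η) ∈ L (f x) ∧
    p.2 = η.comp (pushforward f x)}
  zero_mem' := by
    refine ⟨0, ?_, ?_⟩
    · simp only [Prod.fst_zero, map_zero]; exact (L (f x)).zero_mem
    · ext; simp
  add_mem' := by
    rintro p q ⟨η, hη, hp⟩ ⟨θ, hθ, hq⟩
    refine ⟨η + θ, ?_, ?_⟩
    · simpa using (L (f x)).add_mem hη hθ
    · rw [Prod.snd_add, hp, hq]; rfl
  smul_mem' := by
    rintro c p ⟨η, hη, hp⟩
    refine ⟨c • η, ?_, ?_⟩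
    · simpa using (L (f x)).smul_mem c hη
    · rw [Prod.smul_snd, hp]; rfl

end Pullback

end DiracPullback

end

/-!
The pullback `𝔅L` of a Dirac structure `L` along `f : B → M` is the image of `f^! L` under the
projection `(a, X) ↦ (X, f^* pr_{T*M}(a))`, and the proof follows this projection.

* Linear algebra: the pullback of a Lagrangian subspace by a linear map is Lagrangian, whatever the
  rank (`IsLagrangian.pullback`). So the fibres of `𝔅L` are maximal isotropic, and in particular of
  constant dimension `dim B`.
* Smoothness: in coordinates `f^! L` is the kernel of a smooth family of linear maps. Its rank is
  constant by assumption, so `f^! L` has a smooth local parametrization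
  (`exists_smooth_parametrization_ker`). Its image `𝔅L` also has constant rank, so suitable sections
  of `f^! L` map to a smooth local frame of `𝔅L` (`exists_local_frame`). Hence smooth sections
  of `𝔅L` lift locally to smooth sections of `f^! L` (`exists_local_lift`).
* Involutivity: a Lagrangian fibre is its own orthogonal complement, so it suffices to pair the
  bracket of two sections of `𝔅L` with an element of `𝔅L`. By the lifts, the sections are related
  by `f` to combinations `∑ gᵢ aᵢ` of a frame `a` of `L`, with `gᵢ` functions on `B`. The pairing of
  the bracket with an isotropic fibre is tensorial, and compatible with pullback, so the `gᵢ` may be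
  frozen at the point in question (`courantForm_pullback`); the pairing is then that of a bracket of
  sections of `L` with an element of `L`, which is zero.
* Foliations: a Dirac structure induces a singular foliation, locally generated by the anchor images
  of a frame (`IsDirac.isSingularFoliation`). Sections of `f^! L` project to sections of `𝔅L` with
  the same vector field. Conversely the local lifts of a section of `𝔅L`, glued by a partition of
  unity, form a section of `f^! L` with the same vector field and no larger support
  (`diracFoliation_subset`).
-/

noncomputable section

namespace DiracPullback

/-! ### Lagrangian subspaces of `V × V*` -/

section LinearAlgebra

variable {V : Type*} [AddCommGroup V] [Module ℝ V] [TopologicalSpace V]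

/-- A subspace of `V × V*` is Lagrangian if it equals its own orthogonal complement for the
pairing `⟨(v, ξ), (w, η)⟩ = ξ(w) + η(v)`. -/
def IsLagrangian (L : Submodule ℝ (V × (V →L[ℝ] ℝ))) : Prop :=
  ∀ a, a ∈ L ↔ ∀ b ∈ L, a.2 b.1 + b.2 a.1 = 0

theorem IsLagrangian.maximal {L : Submodule ℝ (V × (V →L[ℝ] ℝ))} (hL : IsLagrangian L) :
    Maximal (fun L : Submodule ℝ (V × (V →L[ℝ] ℝ)) =>
      ∀ a ∈ L, ∀ b ∈ L, a.2 b.1 + b.2 a.1 = 0) L :=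
  ⟨fun _ ha => (hL _).1 ha, fun _ hD hle _ ha => (hL _).2 fun _ hb => hD _ ha _ (hle hb)⟩

variable [IsTopologicalAddGroup V] [ContinuousSMul ℝ V] [T2Space V] [FiniteDimensional ℝ V]

theorem exists_annihilating_of_notMem (R : Submodule ℝ V) {w : V} (hw : w ∉ R) :
    ∃ α : V →L[ℝ] ℝ, (∀ v ∈ R, α v = 0) ∧ α w ≠ 0 := by
  obtain ⟨φ, h1, h2⟩ := Submodule.exists_le_ker_of_notMem hw
  exact ⟨LinearMap.toContinuousLinearMap φ, fun v hv => h2 hv, h1⟩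

/-- An isotropic subspace `L` is Lagrangian if it contains `(0, α)` for all `α` in the annihilator
of its projection to `V`. Only these `α` have to be tested, because an element orthogonal to `L`
has its first component in that projection. -/
theorem isLagrangian_of_annihilator {L : Submodule ℝ (V × (V →L[ℝ] ℝ))}
    (hiso : ∀ a ∈ L, ∀ b ∈ L, a.2 b.1 + b.2 a.1 = 0)
    (hann : ∀ α : V →L[ℝ] ℝ, (∀ b ∈ L, α b.1 = 0) → ((0 : V), α) ∈ L) : IsLagrangian L := by
  rintro ⟨w, β⟩
  refine ⟨fun h b hb => hiso _ h b hb, fun h => ?_⟩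
  have hw : w ∈ L.map (LinearMap.fst ℝ V (V →L[ℝ] ℝ)) := by
    by_contra hw
    obtain ⟨α, h1, h2⟩ := exists_annihilating_of_notMem _ hw
    have := h _ (hann α fun b hb => h1 _ ⟨b, hb, rfl⟩)
    simp at this
    exact h2 this
  obtain ⟨⟨w', β'⟩, hb', rfl⟩ := hw
  have h3 : ((0 : V), β - β') ∈ L := by
    refine hann _ fun b hb => ?_
    have h4 := h b hb
    have h5 := hiso _ hb' b hb
    simp only [LinearMap.fst_apply] at h4 h5
    simp only [sub_apply]
    linarith
  simpa using L.add_mem hb' h3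

theorem isLagrangian_of_maximal {L : Submodule ℝ (V × (V →L[ℝ] ℝ))}
    (hL : Maximal (fun L : Submodule ℝ (V × (V →L[ℝ] ℝ)) =>
      ∀ a ∈ L, ∀ b ∈ L, a.2 b.1 + b.2 a.1 = 0) L) : IsLagrangian L := by
  refine isLagrangian_of_annihilator hL.prop fun α hα => ?_
  have := hL.le_of_ge (y := L ⊔ Submodule.span ℝ {((0 : V), α)}) ?_ le_sup_left
  · exact this (Submodule.mem_sup_right (Submodule.mem_span_singleton_self _))
  · intro a ha b hb
    obtain ⟨a, haL, a', ha', rfl⟩ := Submodule.mem_sup.1 ha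
    obtain ⟨b, hbL, b', hb', rfl⟩ := Submodule.mem_sup.1 hb
    obtain ⟨s, rfl⟩ := Submodule.mem_span_singleton.1 ha'
    obtain ⟨t, rfl⟩ := Submodule.mem_span_singleton.1 hb'
    have := hL.prop a haL b hbL
    simp [hα a haL, hα b hbL, this]

/-- The pullback of a Lagrangian subspace by a linear map `A` is Lagrangian, without any rank
condition: the covectors that annihilate its projection `A⁻¹(pr L)` are those of the form `α ∘ A`
with `α` in the annihilator of `pr L`. -/
theorem IsLagrangian.pullback {L : Submodule ℝ (V × (V →L[ℝ] ℝ))} (hL : IsLagrangian L)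
    {V' : Type*} [AddCommGroup V'] [Module ℝ V'] [TopologicalSpace V']
    [IsTopologicalAddGroup V'] [ContinuousSMul ℝ V'] [T2Space V'] [FiniteDimensional ℝ V']
    (A : V' →L[ℝ] V) {D : Submodule ℝ (V' × (V' →L[ℝ] ℝ))}
    (hD : ∀ p, p ∈ D ↔ ∃ η : V →L[ℝ] ℝ, (A p.1, η) ∈ L ∧ p.2 = η.comp A) : IsLagrangian D := by
  refine isLagrangian_of_annihilator ?_ fun ζ hζ => ?_
  · rintro ⟨a, _⟩ ha ⟨b, _⟩ hb
    obtain ⟨η, h1, rfl⟩ := (hD _).1 ha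
    obtain ⟨θ, h2, rfl⟩ := (hD _).1 hb
    exact (hL _).1 h1 _ h2
  · set R := L.map (LinearMap.fst ℝ V (V →L[ℝ] ℝ)) with hR
    have h1 : (ζ : V' →ₗ[ℝ] ℝ) ∈ (LinearMap.ker (R.mkQ ∘ₗ (A : V' →ₗ[ℝ] V))).dualAnnihilator := by
      rw [Submodule.mem_dualAnnihilator]
      intro v hv
      have hv' : A v ∈ R := by simpa using hv
      obtain ⟨⟨w, β⟩, hw, h⟩ := hv'
      simp only [LinearMap.fst_apply] at h
      subst h
      exact hζ (v, β.comp A) ((hD _).2 ⟨β, hw, rfl⟩)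
    rw [← LinearMap.range_dualMap_eq_dualAnnihilator_ker] at h1
    obtain ⟨φ, hφ⟩ := h1
    refine (hD _).2 ⟨LinearMap.toContinuousLinearMap (φ ∘ₗ R.mkQ), ?_, ?_⟩
    · simp only [map_zero]
      refine (hL _).2 fun b hb => ?_
      have : R.mkQ b.1 = 0 := by
        rw [Submodule.mkQ_apply, Submodule.Quotient.mk_eq_zero]
        exact ⟨b, hb, rfl⟩
      simp only [map_zero, add_zero]
      change φ (R.mkQ b.1) = 0
      rw [this, map_zero]
    · ext v
      exact (LinearMap.congr_fun hφ v).symm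

/-- The kernel of the projection of `L` to `V` is the annihilator of its image. -/
theorem IsLagrangian.finrank_eq {L : Submodule ℝ (V × (V →L[ℝ] ℝ))} (hL : IsLagrangian L) :
    Module.finrank ℝ L = Module.finrank ℝ V := by
  set R := L.map (LinearMap.fst ℝ V (V →L[ℝ] ℝ)) with hR
  let p : L →ₗ[ℝ] V := LinearMap.fst ℝ V (V →L[ℝ] ℝ) ∘ₗ L.subtype
  have hp : LinearMap.range p = R := by
    rw [LinearMap.range_comp, Submodule.range_subtype]
  let e : LinearMap.ker p ≃ₗ[ℝ] R.dualAnnihilator :=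
    LinearEquiv.ofBijective
      (LinearMap.codRestrict _ ((ContinuousLinearMap.coeLM ℝ) ∘ₗ
        LinearMap.snd ℝ V (V →L[ℝ] ℝ) ∘ₗ L.subtype ∘ₗ (LinearMap.ker p).subtype) (by
          rintro ⟨⟨⟨v, β⟩, ha⟩, h0⟩
          have h0 : v = 0 := h0
          subst h0
          rw [Submodule.mem_dualAnnihilator]
          rintro _ ⟨b, hb, rfl⟩
          have := (hL _).1 ha b hb
          simpa using this)) (by
      constructor
      · rintro ⟨⟨⟨v, β⟩, ha⟩, h0⟩ ⟨⟨⟨w, γ⟩, hb⟩, h1⟩ h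
        have h0 : v = 0 := h0
        have h1 : w = 0 := h1
        have h2 : (β : V →ₗ[ℝ] ℝ) = γ := congrArg Subtype.val h
        have h3 : β = γ := ContinuousLinearMap.coe_injective h2
        subst h0 h1 h3
        rfl
      · rintro ⟨φ, hφ⟩
        rw [Submodule.mem_dualAnnihilator] at hφ
        refine ⟨⟨⟨(0, LinearMap.toContinuousLinearMap φ), (hL _).2 fun b hb => ?_⟩, rfl⟩, ?_⟩
        · simpa using hφ _ ⟨b, hb, rfl⟩
        · ext v
          rfl)
  have : FiniteDimensional ℝ (V →L[ℝ] ℝ) :=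
    (LinearMap.toContinuousLinearMap (𝕜 := ℝ) (E := V) (F' := ℝ)).finiteDimensional
  have h1 := LinearMap.finrank_range_add_finrank_ker (K := ℝ) (V := L) (V₂ := V) p
  rw [hp, e.finrank_eq, Subspace.finrank_add_finrank_dualAnnihilator_eq] at h1
  exact h1.symm

end LinearAlgebra

/-! ### Smooth families of linear maps of constant rank -/

section Families

variable {E' : Type*} [NormedAddCommGroup E'] [NormedSpace ℝ E']
  {B : Type*} [TopologicalSpace B] [ChartedSpace E' B]
  {V : Type*} [NormedAddCommGroup V] [NormedSpace ℝ V]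
  {W : Type*} [NormedAddCommGroup W] [NormedSpace ℝ W]

/-- Near a point where it is invertible, a smooth family of linear maps consists of invertible
maps, and the inverses depend smoothly on the point. -/
theorem exists_contMDiffOn_inverse [FiniteDimensional ℝ V] {U : Set B} (hU : IsOpen U) {x₀ : B}
    (hx₀ : x₀ ∈ U)
    {T : B → V →L[ℝ] W} (hT : ContMDiffOn 𝓘(ℝ, E') 𝓘(ℝ, V →L[ℝ] W) ∞ T U)
    (e : V ≃L[ℝ] W) (he : T x₀ = e) :
    ∃ U' ⊆ U, IsOpen U' ∧ x₀ ∈ U' ∧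
      ContMDiffOn 𝓘(ℝ, E') 𝓘(ℝ, W →L[ℝ] V) ∞ (fun x => (T x).inverse) U' ∧
      ∀ x ∈ U', ∃ e : V ≃L[ℝ] W, T x = e := by
  have hc : CompleteSpace V := FiniteDimensional.complete ℝ V
  refine ⟨U ∩ T ⁻¹' (Set.range ContinuousLinearEquiv.toContinuousLinearMap),
    Set.inter_subset_left, hT.continuousOn.isOpen_inter_preimage hU ContinuousLinearEquiv.isOpen,
    ⟨hx₀, e, he.symm⟩, ?_, ?_⟩
  · rintro x ⟨hx, e', he'⟩
    have h1 : ContDiffAt ℝ ∞ (ContinuousLinearMap.inverse : (V →L[ℝ] W) → _) (T x) := by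
      rw [← he']
      exact contDiffAt_map_inverse e'
    exact h1.contMDiffAt.comp_contMDiffWithinAt x ((hT x hx).mono Set.inter_subset_left)
  · rintro x ⟨_, e', he'⟩
    exact ⟨e', he'.symm⟩

/-- The kernels of a smooth family of linear maps of constant rank are, locally, the ranges of a
smooth family of injective maps. Near `x₀` the map `A x` together with a projection onto
`ker (A x₀)` is invertible onto `range (A x₀) × ker (A x₀)`, and its inverse parametrizes the
kernel of `A x` by the second factor. -/
theorem exists_smooth_parametrization_ker [FiniteDimensional ℝ V] [FiniteDimensional ℝ W]
    {U : Set B} (hU : IsOpen U) {x₀ : B} (hx₀ : x₀ ∈ U)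
    {A : B → V →L[ℝ] W} (hA : ContMDiffOn 𝓘(ℝ, E') 𝓘(ℝ, V →L[ℝ] W) ∞ A U) {d : ℕ}
    (hd : ∀ x ∈ U, Module.finrank ℝ (LinearMap.ker (A x : V →ₗ[ℝ] W)) = d) :
    ∃ U' ⊆ U, IsOpen U' ∧ x₀ ∈ U' ∧ ∃ (K : Submodule ℝ V) (P : B → K →L[ℝ] V),
      ContMDiffOn 𝓘(ℝ, E') 𝓘(ℝ, K →L[ℝ] V) ∞ P U' ∧
      ∀ x ∈ U', Function.Injective (P x) ∧
        LinearMap.range (P x : K →ₗ[ℝ] V) = LinearMap.ker (A x : V →ₗ[ℝ] W) := by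
  set K := LinearMap.ker (A x₀ : V →ₗ[ℝ] W) with hK
  set R := LinearMap.range (A x₀ : V →ₗ[ℝ] W) with hR
  obtain ⟨π, hπ⟩ := LinearMap.exists_leftInverse_of_injective K.subtype (Submodule.ker_subtype K)
  obtain ⟨ρ, hρ⟩ := LinearMap.exists_leftInverse_of_injective R.subtype (Submodule.ker_subtype R)
  let πc : V →L[ℝ] K := LinearMap.toContinuousLinearMap π
  let ρc : W →L[ℝ] R := LinearMap.toContinuousLinearMap ρ
  let T : B → V →L[ℝ] R × K := fun x =>
    (ContinuousLinearMap.inl ℝ R K).comp (ρc.comp (A x)) + (ContinuousLinearMap.inr ℝ R K).comp πc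
  have hTapp : ∀ x v, T x v = (ρ (A x v), π v) := fun x v => by
    simp [T, πc, ρc]
  have hT : ContMDiffOn 𝓘(ℝ, E') 𝓘(ℝ, V →L[ℝ] R × K) ∞ T U :=
    ((contMDiffOn_const.clm_comp (contMDiffOn_const.clm_comp hA)).add contMDiffOn_const)
  have hinj : Function.Injective (T x₀ : V →ₗ[ℝ] R × K) := by
    rw [injective_iff_map_eq_zero]
    intro v hv
    have hv : T x₀ v = 0 := hv
    rw [hTapp, Prod.mk_eq_zero] at hv
    have h1 : A x₀ v = 0 := by
      have := LinearMap.congr_fun hρ ⟨A x₀ v, v, rfl⟩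
      simp only [LinearMap.comp_apply, Submodule.subtype_apply, hv.1, LinearMap.id_apply] at this
      exact (congrArg Subtype.val this).symm
    have := LinearMap.congr_fun hπ ⟨v, h1⟩
    simp only [LinearMap.comp_apply, Submodule.subtype_apply, hv.2, LinearMap.id_apply] at this
    exact (congrArg Subtype.val this).symm
  have hdim : Module.finrank ℝ V = Module.finrank ℝ (R × K) := by
    rw [Module.finrank_prod, hR, hK, LinearMap.finrank_range_add_finrank_ker]
  let e := (LinearEquiv.ofInjectiveOfFinrankEq _ hinj hdim).toContinuousLinearEquiv
  obtain ⟨U', hU'U, hU', hx₀', hinv, hequiv⟩ := exists_contMDiffOn_inverse hU hx₀ hT e (by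
    ext v : 1
    rfl)
  refine ⟨U', hU'U, hU', hx₀', K, fun x => (T x).inverse.comp (ContinuousLinearMap.inr ℝ R K),
    hinv.clm_comp contMDiffOn_const, fun x hx => ?_⟩
  obtain ⟨e', he'⟩ := hequiv x hx
  have hP : ∀ k : K, ((T x).inverse.comp (ContinuousLinearMap.inr ℝ R K)) k
      = e'.symm ((0 : R), k) := fun k => by
    rw [he', ContinuousLinearMap.inverse_equiv]
    rfl
  have hPinj : Function.Injective ((T x).inverse.comp (ContinuousLinearMap.inr ℝ R K)) := by
    intro k k' h
    rw [hP, hP] at h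
    exact (Prod.mk.injEq _ _ _ _ ▸ e'.symm.injective h).2
  refine ⟨hPinj, (Submodule.eq_of_le_of_finrank_eq ?_ ?_).symm⟩
  · intro v hv
    have hv : A x v = 0 := hv
    refine ⟨π v, ?_⟩
    change ((T x).inverse.comp (ContinuousLinearMap.inr ℝ R K)) (π v) = v
    rw [hP, ContinuousLinearEquiv.symm_apply_eq]
    have : T x v = e' v := by rw [he']; rfl
    rw [← this, hTapp, hv, map_zero]
  · rw [LinearMap.finrank_range_of_inj hPinj, hd x (hU'U hx), hK, hd x₀ hx₀]

theorem exists_leftInverse_clm [FiniteDimensional ℝ W] (N : V →L[ℝ] W) (hN : Function.Injective N) :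
    ∃ S : W →L[ℝ] V, ∀ v, S (N v) = v := by
  obtain ⟨S, hS⟩ := LinearMap.exists_leftInverse_of_injective (N : V →ₗ[ℝ] W)
    (LinearMap.ker_eq_bot.2 hN)
  exact ⟨LinearMap.toContinuousLinearMap S, fun v => LinearMap.congr_fun hS v⟩

/-- The ranges of a smooth family of linear maps of constant rank are, locally, the isomorphic
images of a fixed subspace: a complement of the kernel at one point, on which the maps stay
injective nearby. -/
theorem exists_subspace_injective_range [FiniteDimensional ℝ V] [FiniteDimensional ℝ W]
    {U : Set B} (hU : IsOpen U) {x₀ : B} (hx₀ : x₀ ∈ U)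
    {N : B → V →L[ℝ] W} (hN : ContMDiffOn 𝓘(ℝ, E') 𝓘(ℝ, V →L[ℝ] W) ∞ N U) {d : ℕ}
    (hd : ∀ x ∈ U, Module.finrank ℝ (LinearMap.range (N x : V →ₗ[ℝ] W)) = d) :
    ∃ U' ⊆ U, IsOpen U' ∧ x₀ ∈ U' ∧ ∃ K : Submodule ℝ V,
      ∀ x ∈ U', Function.Injective ((N x).comp K.subtypeL) ∧
        LinearMap.range ((N x).comp K.subtypeL : K →ₗ[ℝ] W)
          = LinearMap.range (N x : V →ₗ[ℝ] W) := by
  obtain ⟨K, hK⟩ := Submodule.exists_isCompl (LinearMap.ker (N x₀ : V →ₗ[ℝ] W))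
  have hinj : Function.Injective ((N x₀).comp K.subtypeL) := by
    rw [injective_iff_map_eq_zero]
    intro k hk
    have : (k : V) ∈ LinearMap.ker (N x₀ : V →ₗ[ℝ] W) ⊓ K := ⟨hk, k.2⟩
    rw [hK.inf_eq_bot, Submodule.mem_bot] at this
    exact Subtype.ext this
  obtain ⟨S, hS⟩ := exists_leftInverse_clm _ hinj
  have hKd : Module.finrank ℝ K = d := by
    have h1 := Submodule.finrank_add_eq_of_isCompl hK
    have h2 := LinearMap.finrank_range_add_finrank_ker (N x₀ : V →ₗ[ℝ] W)
    rw [hd x₀ hx₀] at h2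
    omega
  obtain ⟨U', hU'U, hU', hx₀', -, hequiv⟩ := exists_contMDiffOn_inverse hU hx₀
    (T := fun x => S.comp ((N x).comp K.subtypeL))
    (contMDiffOn_const.clm_comp (hN.clm_comp contMDiffOn_const))
    (ContinuousLinearEquiv.refl ℝ K) (by ext k : 1; exact hS k)
  refine ⟨U', hU'U, hU', hx₀', K, fun x hx => ?_⟩
  obtain ⟨e', he'⟩ := hequiv x hx
  have hxinj : Function.Injective ((N x).comp K.subtypeL) := by
    intro k k' h
    refine e'.injective ?_
    have := congrArg S h
    have h1 : ∀ k, S (((N x).comp K.subtypeL) k) = e' k := fun k =>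
      congrArg (fun T : K →L[ℝ] K => T k) he'
    rwa [h1, h1] at this
  refine ⟨hxinj, Submodule.eq_of_le_of_finrank_eq ?_ ?_⟩
  · rintro _ ⟨k, rfl⟩
    exact ⟨k, rfl⟩
  · rw [LinearMap.finrank_range_of_inj hxinj, hd x (hU'U hx), hKd]

/-- If `N` is a smooth family of injective maps, then `c` is smooth as soon as `x ↦ N x (c x)`
is. -/
theorem contMDiffOn_of_injective_family [FiniteDimensional ℝ V] [FiniteDimensional ℝ W]
    {U : Set B} (hU : IsOpen U)
    {N : B → V →L[ℝ] W} (hN : ContMDiffOn 𝓘(ℝ, E') 𝓘(ℝ, V →L[ℝ] W) ∞ N U)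
    (hinj : ∀ x ∈ U, Function.Injective (N x)) {c : B → V}
    (hc : ContMDiffOn 𝓘(ℝ, E') 𝓘(ℝ, W) ∞ (fun x => N x (c x)) U) :
    ContMDiffOn 𝓘(ℝ, E') 𝓘(ℝ, V) ∞ c U := by
  intro x₀ hx₀
  obtain ⟨S, hS⟩ := exists_leftInverse_clm _ (hinj x₀ hx₀)
  obtain ⟨U', hU'U, hU', hx₀', hinv, hequiv⟩ := exists_contMDiffOn_inverse hU hx₀
    (T := fun x => S.comp (N x)) (contMDiffOn_const.clm_comp hN)
    (ContinuousLinearEquiv.refl ℝ V) (by ext k : 1; exact hS k)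
  have h1 : ContMDiffOn 𝓘(ℝ, E') 𝓘(ℝ, V) ∞ c U' := by
    refine (hinv.clm_apply ((contMDiffOn_const (c := S)).clm_apply (hc.mono hU'U))).congr
      fun x hx => ?_
    obtain ⟨e', he'⟩ := hequiv x hx
    rw [he', ContinuousLinearMap.inverse_equiv]
    have : S (N x (c x)) = e' (c x) := congrArg (fun T : V →L[ℝ] V => T (c x)) he'
    rw [this]
    exact (e'.symm_apply_apply _).symm
  exact (h1.contMDiffAt (hU'.mem_nhds hx₀')).contMDiffWithinAt

end Families

/-! ### Vectors and covectors in the coordinates of a chart -/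

section Coordinates

variable {E : Type*} [NormedAddCommGroup E] [NormedSpace ℝ E]
  {M : Type*} [TopologicalSpace M] [ChartedSpace E M] [IsManifold 𝓘(ℝ, E) ∞ M]
  {E' : Type*} [NormedAddCommGroup E'] [NormedSpace ℝ E']
  {B : Type*} [TopologicalSpace B] [ChartedSpace E' B]

/-- Tangent vectors at `x` read in the model space, through the trivialization of the tangent
bundle given by the preferred chart at `x₀`. -/
def toModel (x₀ x : M) : Tan E x →L[ℝ] E :=
  (trivializationAt E (TangentSpace 𝓘(ℝ, E)) x₀).continuousLinearMapAt ℝ x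

/-- The inverse of `toModel`, for `x` in the source of the preferred chart at `x₀`. -/
def ofModel (x₀ x : M) : E →L[ℝ] Tan E x :=
  (trivializationAt E (TangentSpace 𝓘(ℝ, E)) x₀).symmL ℝ x

theorem ofModel_toModel {x₀ x : M} (hx : x ∈ (chartAt E x₀).source) (v : Tan E x) :
    ofModel x₀ x (toModel x₀ x v) = v :=
  (trivializationAt E (TangentSpace 𝓘(ℝ, E)) x₀).symmL_continuousLinearMapAt (R := ℝ) hx v

theorem toModel_ofModel {x₀ x : M} (hx : x ∈ (chartAt E x₀).source) (v : E) :
    toModel x₀ x (ofModel x₀ x v) = v :=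
  (trivializationAt E (TangentSpace 𝓘(ℝ, E)) x₀).continuousLinearMapAt_symmL (R := ℝ) hx v

/-- A covector at `x` read in the model space. -/
def covectorToModel (x₀ x : M) (ξ : Cotan E x) : E →L[ℝ] ℝ :=
  ContinuousLinearMap.comp (M₃ := ℝ) ξ (ofModel x₀ x)

theorem covectorToModel_apply (x₀ x : M) (ξ : Cotan E x) (v : E) :
    covectorToModel x₀ x ξ v = evalCovector ξ (ofModel x₀ x v) := rfl

/-- A section `Y` of `f^* TM` is smooth if and only if `f` and the coordinates of `Y` are. -/
theorem contMDiffOn_vector_iff {f : B → M} {U : Set B} {y₀ : M}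
    (hU : Set.MapsTo f U (chartAt E y₀).source) (Y : ∀ x, Tan E (f x)) :
    ContMDiffOn 𝓘(ℝ, E') (𝓘(ℝ, E).prod 𝓘(ℝ, E)) ∞
        (fun x => (⟨f x, Y x⟩ : TangentBundle 𝓘(ℝ, E) M)) U ↔
      ContMDiffOn 𝓘(ℝ, E') 𝓘(ℝ, E) ∞ f U ∧
      ContMDiffOn 𝓘(ℝ, E') 𝓘(ℝ, E) ∞ (fun x => toModel y₀ (f x) (Y x)) U := by
  rw [Bundle.Trivialization.contMDiffOn_iff (e := trivializationAt E (TangentSpace 𝓘(ℝ, E)) y₀)]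
  · refine and_congr_right fun _ => contMDiffOn_congr fun x hx => ?_
    exact (congrFun ((trivializationAt E (TangentSpace 𝓘(ℝ, E)) y₀).coe_linearMapAt_of_mem
      (R := ℝ) (hU hx)) (Y x)).symm
  · intro x hx
    rw [Bundle.Trivialization.mem_source]
    exact hU hx

/-- A section `ξ` of `f^* T*M` is smooth if and only if `f` and the coordinates of `ξ` are. -/
theorem contMDiffOn_covector_iff {f : B → M} {U : Set B} {y₀ : M}
    (hU : Set.MapsTo f U (chartAt E y₀).source) (ξ : ∀ x, Cotan E (f x)) :
    ContMDiffOn 𝓘(ℝ, E') (𝓘(ℝ, E).prod 𝓘(ℝ, E →L[ℝ] ℝ)) ∞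
        (fun x => (⟨f x, ξ x⟩ : Bundle.TotalSpace (E →L[ℝ] ℝ) (fun y : M => Cotan E y))) U ↔
      ContMDiffOn 𝓘(ℝ, E') 𝓘(ℝ, E) ∞ f U ∧
      ContMDiffOn 𝓘(ℝ, E') 𝓘(ℝ, E →L[ℝ] ℝ) ∞ (fun x => covectorToModel y₀ (f x) (ξ x)) U := by
  rw [Bundle.Trivialization.contMDiffOn_iff
    (e := trivializationAt (E →L[ℝ] ℝ) (fun y : M => Cotan E y) y₀)]
  · refine and_congr_right fun _ => contMDiffOn_congr fun x hx => ?_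
    rw [hom_trivializationAt_apply]
    ext v
    simp [ContinuousLinearMap.inCoordinates, covectorToModel_apply, evalCovector, ofModel]
  · intro x hx
    rw [Bundle.Trivialization.mem_source, hom_trivializationAt_baseSet]
    exact ⟨hU hx, trivial⟩

/-- A family of linear maps on a finite-dimensional space is smooth if it is pointwise smooth. -/
theorem contMDiffOn_clm_of_apply [FiniteDimensional ℝ E] {W : Type*} [NormedAddCommGroup W]
    [NormedSpace ℝ W] {U : Set B} {T : B → E →L[ℝ] W}
    (h : ∀ v, ContMDiffOn 𝓘(ℝ, E') 𝓘(ℝ, W) ∞ (fun x => T x v) U) :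
    ContMDiffOn 𝓘(ℝ, E') 𝓘(ℝ, E →L[ℝ] W) ∞ T U := by
  let b := Module.finBasis ℝ E
  have h1 : T = fun x => ∑ i, ContinuousLinearMap.smulRightL ℝ E W
      (LinearMap.toContinuousLinearMap (b.coord i)) (T x (b i)) := by
    ext x v
    rw [sum_apply]
    conv_lhs => rw [← b.sum_repr v, map_sum]
    simp
  rw [h1]
  exact contMDiffOn_finsetSum fun i _ =>
    (contMDiffOn_const (c := ContinuousLinearMap.smulRightL ℝ E W _)).clm_apply (h (b i))

theorem contMDiffOn_ofModel (x₀ : M) (v : E) :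
    SmoothVectorFieldOn (fun x : M => ofModel x₀ x v) (chartAt E x₀).source := by
  refine (contMDiffOn_vector_iff (f := id) (y₀ := x₀) (fun _ hx => hx) _).2 ⟨contMDiffOn_id, ?_⟩
  exact contMDiffOn_const.congr fun x hx => toModel_ofModel hx v

theorem contMDiffOn_pushforward [IsManifold 𝓘(ℝ, E') ∞ B] {f : B → M}
    (hf : ContMDiff 𝓘(ℝ, E') 𝓘(ℝ, E) ∞ f)
    {X : ∀ x : B, Tan E' x} {U : Set B} (hX : SmoothVectorFieldOn (E := E') X U) :
    ContMDiffOn 𝓘(ℝ, E') (𝓘(ℝ, E).prod 𝓘(ℝ, E)) ∞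
      (fun x => (⟨f x, pushforward f x (X x)⟩ : TangentBundle 𝓘(ℝ, E) M)) U := by
  have h : ContMDiff (𝓘(ℝ, E').prod 𝓘(ℝ, E')) (𝓘(ℝ, E).prod 𝓘(ℝ, E)) ∞
      (tangentMap 𝓘(ℝ, E') 𝓘(ℝ, E) f) := hf.contMDiff_tangentMap (by simp)
  exact h.comp_contMDiffOn hX

theorem contMDiffOn_pushforward_coord [FiniteDimensional ℝ E'] [IsManifold 𝓘(ℝ, E') ∞ B]
    {f : B → M} (hf : ContMDiff 𝓘(ℝ, E') 𝓘(ℝ, E) ∞ f) {x₀ : B} {y₀ : M} {U : Set B}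
    (hU : U ⊆ (chartAt E' x₀).source) (hfU : Set.MapsTo f U (chartAt E y₀).source) :
    ContMDiffOn 𝓘(ℝ, E') 𝓘(ℝ, E' →L[ℝ] E) ∞
      (fun x => (toModel (E := E) y₀ (f x)).comp
        ((pushforward (E := E) (E' := E') f x).comp (ofModel (E := E') x₀ x))) U := by
  refine contMDiffOn_clm_of_apply fun v => ?_
  exact ((contMDiffOn_vector_iff hfU _).1
    (contMDiffOn_pushforward hf ((contMDiffOn_ofModel x₀ v).mono hU))).2

end Coordinates

/-! ### Smooth sections and frames of `TM ⊕ T*M` -/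

section Frames

variable {E : Type*} [NormedAddCommGroup E] [NormedSpace ℝ E]
  {M : Type*} [TopologicalSpace M] [ChartedSpace E M] [IsManifold 𝓘(ℝ, E) ∞ M]

/-- Elements of `T_x M ⊕ T*_x M` read in the model space, for `x` in the source of the preferred
chart at `x₀`. -/
def genToModel {x₀ x : M} (hx : x ∈ (chartAt E x₀).source) :
    GenTan E x ≃ₗ[ℝ] E × (E →L[ℝ] ℝ) where
  toFun a := (toModel x₀ x a.1, covectorToModel x₀ x a.2)
  map_add' a b := by
    refine Prod.ext (map_add _ _ _) ?_
    ext v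
    rfl
  map_smul' c a := by
    refine Prod.ext (map_smul _ _ _) ?_
    ext v
    rfl
  invFun p := (ofModel x₀ x p.1, p.2.comp (toModel x₀ x))
  left_inv a := by
    refine Prod.ext (ofModel_toModel hx _) ?_
    ext v
    exact congrArg a.2 (ofModel_toModel hx v)
  right_inv p := by
    refine Prod.ext (toModel_ofModel hx _) ?_
    ext v
    exact congrArg p.2 (toModel_ofModel hx v)

theorem genToModel_apply {x₀ x : M} (hx : x ∈ (chartAt E x₀).source) (a : GenTan E x) :
    genToModel hx a = (toModel x₀ x a.1, covectorToModel x₀ x a.2) := rfl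

theorem smoothGenSectionOn_iff {U : Set M} {x₀ : M} (hU : U ⊆ (chartAt E x₀).source)
    (σ : ∀ x : M, GenTan E x) :
    SmoothGenSectionOn σ U ↔ ContMDiffOn 𝓘(ℝ, E) 𝓘(ℝ, E × (E →L[ℝ] ℝ)) ∞
      (fun x => (toModel x₀ x (σ x).1, covectorToModel x₀ x (σ x).2)) U := by
  have h1 := contMDiffOn_vector_iff (E' := E) (B := M) (f := id) (U := U) (y₀ := x₀)
    (fun _ hx => hU hx) (fun x => (σ x).1)
  have h2 := contMDiffOn_covector_iff (E' := E) (B := M) (f := id) (U := U) (y₀ := x₀)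
    (fun _ hx => hU hx) (fun x => (σ x).2)
  refine (and_congr h1 h2).trans ⟨fun h => h.1.2.prodMk_space h.2.2, fun h => ?_⟩
  exact ⟨⟨contMDiffOn_id, (ContinuousLinearMap.fst ℝ E (E →L[ℝ] ℝ)).contMDiff.comp_contMDiffOn h⟩,
    ⟨contMDiffOn_id, (ContinuousLinearMap.snd ℝ E (E →L[ℝ] ℝ)).contMDiff.comp_contMDiffOn h⟩⟩

theorem SmoothGenSectionOn.mono {σ : ∀ x : M, GenTan E x} {U U' : Set M}
    (h : SmoothGenSectionOn σ U) (hU : U' ⊆ U) : SmoothGenSectionOn σ U' :=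
  ⟨ContMDiffOn.mono h.1 hU, ContMDiffOn.mono h.2 hU⟩

theorem SmoothGenSectionOn.congr {σ τ : ∀ x : M, GenTan E x} {U : Set M}
    (h : SmoothGenSectionOn σ U) (hστ : ∀ x ∈ U, τ x = σ x) : SmoothGenSectionOn τ U :=
  ⟨ContMDiffOn.congr h.1 fun x hx => by simp only [hστ x hx],
    ContMDiffOn.congr h.2 fun x hx => by simp only [hστ x hx]⟩

theorem SmoothGenSectionOn.sum_smul {n : ℕ} {s : Fin n → ∀ x : M, GenTan E x} {U : Set M}
    (hs : ∀ k, SmoothGenSectionOn (s k) U) {c : Fin n → M → ℝ}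
    (hc : ∀ k, ContMDiffOn 𝓘(ℝ, E) 𝓘(ℝ, ℝ) ∞ (c k) U) :
    SmoothGenSectionOn (fun x => ∑ k, c k x • s k x) U := by
  constructor
  · refine (ContMDiffOn.sum_section (s := Finset.univ)
      fun k _ => (hc k).smul_section (hs k).1).congr fun x _ => ?_
    simp only [Prod.fst_sum, Prod.smul_fst]
    rfl
  · refine (ContMDiffOn.sum_section (s := Finset.univ)
      fun k _ => (hc k).smul_section (hs k).2).congr fun x _ => ?_
    simp only [Prod.snd_sum, Prod.smul_snd]
    rfl

/-- The product of a smooth function with support in the open set `U` and a section that is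
smooth on `U` is smooth everywhere. -/
theorem SmoothGenSectionOn.smul_of_tsupport {σ : ∀ x : M, GenTan E x} {U : Set M} (hU : IsOpen U)
    (hσ : SmoothGenSectionOn σ U) {ρ : M → ℝ} (hρ : ContMDiff 𝓘(ℝ, E) 𝓘(ℝ, ℝ) ∞ ρ)
    (hsupp : tsupport ρ ⊆ U) : SmoothGenSectionOn (fun x => ρ x • σ x) Set.univ :=
  ⟨(ContMDiffOn.smul_section_of_tsupport hρ.contMDiffOn hU hsupp hσ.1).contMDiffOn,
    (ContMDiffOn.smul_section_of_tsupport hρ.contMDiffOn hU hsupp hσ.2).contMDiffOn⟩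

variable [FiniteDimensional ℝ E]

/-- The coefficients of a smooth section are smooth in a smooth frame, or more generally in
smooth sections that are linearly independent at every point. -/
theorem contMDiffOn_coeff {n : ℕ} {s : Fin n → ∀ x : M, GenTan E x} {U : Set M} (hU : IsOpen U)
    (hs : ∀ k, SmoothGenSectionOn (s k) U)
    (hli : ∀ x ∈ U, LinearIndependent ℝ (fun k => s k x)) {c : Fin n → M → ℝ}
    (hσ : SmoothGenSectionOn (fun x => ∑ k, c k x • s k x) U) (k : Fin n) :
    ContMDiffOn 𝓘(ℝ, E) 𝓘(ℝ, ℝ) ∞ (c k) U := by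
  intro x₀ hx₀
  set U' := U ∩ (chartAt E x₀).source with hU'
  have hU'o : IsOpen U' := hU.inter (chartAt E x₀).open_source
  have hx₀' : x₀ ∈ U' := ⟨hx₀, mem_chart_source E x₀⟩
  let t : Fin n → M → E × (E →L[ℝ] ℝ) := fun k x =>
    (toModel x₀ x (s k x).1, covectorToModel x₀ x (s k x).2)
  let N : M → (Fin n → ℝ) →L[ℝ] E × (E →L[ℝ] ℝ) := fun x =>
    ∑ k, ContinuousLinearMap.smulRightL ℝ (Fin n → ℝ) (E × (E →L[ℝ] ℝ))
      (ContinuousLinearMap.proj k) (t k x)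
  have hN : ContMDiffOn 𝓘(ℝ, E) 𝓘(ℝ, (Fin n → ℝ) →L[ℝ] E × (E →L[ℝ] ℝ)) ∞ N U' :=
    contMDiffOn_finsetSum fun k _ => contMDiffOn_const.clm_apply
      ((smoothGenSectionOn_iff Set.inter_subset_right _).1 ((hs k).mono Set.inter_subset_left))
  have hNapp : ∀ x (hx : x ∈ U') (c : Fin n → ℝ), N x c = genToModel hx.2 (∑ k, c k • s k x) := by
    intro x hx c
    rw [map_sum]
    simp only [map_smul, genToModel_apply]
    simp [N, t]
  have hc : ContMDiffOn 𝓘(ℝ, E) 𝓘(ℝ, Fin n → ℝ) ∞ (fun x k => c k x) U' := by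
    refine contMDiffOn_of_injective_family hU'o hN (fun x hx => ?_) ?_
    · rw [injective_iff_map_eq_zero]
      intro c hc
      rw [hNapp x hx, LinearEquiv.map_eq_zero_iff] at hc
      exact funext (Fintype.linearIndependent_iff.1 (hli x hx.1) c hc)
    · refine ((smoothGenSectionOn_iff Set.inter_subset_right _).1
        (hσ.mono Set.inter_subset_left)).congr fun x hx => ?_
      rw [hNapp x hx]
      rfl
  have h1 : ContMDiffOn 𝓘(ℝ, E) 𝓘(ℝ, ℝ) ∞ (c k) U' :=
    (ContinuousLinearMap.proj (R := ℝ) (φ := fun _ : Fin n => ℝ) k).contMDiff.comp_contMDiffOn hc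
  exact (h1.contMDiffAt (hU'o.mem_nhds hx₀')).contMDiffWithinAt

theorem exists_contMDiff_bump [T2Space M] [SecondCountableTopology M] {K U : Set M}
    (hK : IsCompact K) (hU : IsOpen U) (hKU : K ⊆ U) :
    ∃ ρ : M → ℝ, ContMDiff 𝓘(ℝ, E) 𝓘(ℝ, ℝ) ∞ ρ ∧ HasCompactSupport ρ ∧ tsupport ρ ⊆ U ∧
      ∀ᶠ x in nhdsSet K, ρ x = 1 := by
  have : LocallyCompactSpace M := ChartedSpace.locallyCompactSpace E M
  obtain ⟨K', hK', h1, h2⟩ := exists_compact_between hK hU hKU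
  obtain ⟨ρ, h3, h4, -⟩ := exists_contMDiffMap_one_nhds_of_subset_interior (n := ⊤) 𝓘(ℝ, E)
    hK.isClosed h1
  have h5 : tsupport ρ ⊆ K' := closure_minimal
    (fun x hx => by_contra fun hx' => hx (h4 x hx')) hK'.isClosed
  exact ⟨ρ, ρ.contMDiff, hK'.of_isClosed_subset (isClosed_tsupport _) h5, h5.trans h2, h3⟩

/-- Near every point a smooth subbundle is framed by globally defined smooth sections. -/
theorem IsSmoothSubbundle.exists_global_frame [T2Space M] [SecondCountableTopology M]
    {L : ∀ x : M, Submodule ℝ (GenTan E x)} (hL : IsSmoothSubbundle L) (x₀ : M) :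
    ∃ U : Set M, IsOpen U ∧ x₀ ∈ U ∧ ∃ (r : ℕ) (a : Fin r → ∀ x : M, GenTan E x),
      (∀ i, IsSmoothSection L (a i)) ∧
      ∀ x ∈ U, LinearIndependent ℝ (fun i => a i x) ∧
        Submodule.span ℝ (Set.range fun i => a i x) = L x := by
  obtain ⟨U, hU, hx₀, r, s, hs, hspan⟩ := hL x₀
  obtain ⟨ρ, h1, -, h2, h3⟩ := exists_contMDiff_bump (E := E) isCompact_singleton hU
    (Set.singleton_subset_iff.2 hx₀)
  rw [nhdsSet_singleton] at h3
  obtain ⟨W, hW, hWo, hxW⟩ := eventually_nhds_iff.1 h3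
  refine ⟨U ∩ W, hU.inter hWo, ⟨hx₀, hxW⟩, r, fun i x => ρ x • s i x,
    fun i => ⟨(hs i).smul_of_tsupport hU h1 h2, fun x => ?_⟩, fun x hx => ?_⟩
  · by_cases hx : x ∈ U
    · rw [← (hspan x hx).2]
      exact Submodule.smul_mem _ _ (Submodule.subset_span ⟨i, rfl⟩)
    · change ρ x • s i x ∈ L x
      rw [image_eq_zero_of_notMem_tsupport fun h => hx (h2 h), zero_smul]
      exact (L x).zero_mem
  · simp only [hW x hx.2, one_smul]
    exact hspan x hx.1

end Frames

/-! ### The local frame of the pullback -/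

section Fibres

variable {E : Type*} [NormedAddCommGroup E] [NormedSpace ℝ E] [FiniteDimensional ℝ E]
  {M : Type*} [TopologicalSpace M] [ChartedSpace E M]
  {E' : Type*} [NormedAddCommGroup E'] [NormedSpace ℝ E'] [FiniteDimensional ℝ E']
  {B : Type*} [TopologicalSpace B] [ChartedSpace E' B]

instance (x : M) : T2Space (Tan E x) := inferInstanceAs (T2Space E)

instance (x : M) : FiniteDimensional ℝ (Tan E x) := inferInstanceAs (FiniteDimensional ℝ E)

theorem isLagrangian_of_maximal_isIsotropic {x : M} {L : Submodule ℝ (GenTan E x)}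
    (hL : Maximal IsIsotropic L) : IsLagrangian (V := Tan E x) L :=
  isLagrangian_of_maximal (V := Tan E x) hL

/-- The fibres of `𝔅L` are Lagrangian, even if `f^! L` does not have constant rank. -/
theorem isLagrangian_diracPullback (f : B → M) {L : ∀ y : M, Submodule ℝ (GenTan E y)}
    (hL : ∀ y, Maximal IsIsotropic (L y)) (x : B) :
    IsLagrangian (V := Tan E' x) (diracPullback (E' := E') f L x) :=
  (isLagrangian_of_maximal_isIsotropic (hL (f x))).pullback (V' := Tan E' x) (pushforward f x)
    fun _ => Iff.rfl

theorem maximal_isIsotropic_diracPullback (f : B → M) {L : ∀ y : M, Submodule ℝ (GenTan E y)}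
    (hL : ∀ y, Maximal IsIsotropic (L y)) (x : B) :
    Maximal IsIsotropic (diracPullback (E' := E') f L x) :=
  (isLagrangian_diracPullback f hL x).maximal

theorem finrank_diracPullback (f : B → M) {L : ∀ y : M, Submodule ℝ (GenTan E y)}
    (hL : ∀ y, Maximal IsIsotropic (L y)) (x : B) :
    Module.finrank ℝ (diracPullback (E' := E') f L x) = Module.finrank ℝ E' :=
  (isLagrangian_diracPullback f hL x).finrank_eq (V := Tan E' x)

theorem mem_of_forall_pairing_eq_zero {x : M} {L : Submodule ℝ (GenTan E x)}
    (hL : Maximal IsIsotropic L) {a : GenTan E x} (ha : ∀ b ∈ L, pairing a b = 0) : a ∈ L :=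
  (isLagrangian_of_maximal_isIsotropic hL a).2 ha

end Fibres

section LocalFrame

variable {E : Type*} [NormedAddCommGroup E] [NormedSpace ℝ E] [FiniteDimensional ℝ E]
  {M : Type*} [TopologicalSpace M] [ChartedSpace E M] [IsManifold 𝓘(ℝ, E) ∞ M]
  {E' : Type*} [NormedAddCommGroup E'] [NormedSpace ℝ E'] [FiniteDimensional ℝ E']
  {B : Type*} [TopologicalSpace B] [ChartedSpace E' B] [IsManifold 𝓘(ℝ, E') ∞ B]

set_option synthInstance.maxHeartbeats 200000 in
/-- Near every point the pullback `𝔅L` has a smooth frame `s` that lifts to smooth sections of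
`f^! L`. The lifts are given by their coefficients `g` in a frame `a` of `L`.

In coordinates `f^! L` is the kernel of a family of linear maps, of constant rank by assumption,
and `𝔅L` is the image of `f^! L` under another family, again of constant rank because the fibres
of `𝔅L` are Lagrangian. -/
theorem exists_local_frame {f : B → M} (hf : ContMDiff 𝓘(ℝ, E') 𝓘(ℝ, E) ∞ f)
    {L : ∀ y : M, Submodule ℝ (GenTan E y)} (hL : ∀ y, Maximal IsIsotropic (L y))
    (hsmooth : AlgebroidPullbackSmooth (E' := E') f L) (x₀ : B) {W : Set M} (hW : IsOpen W)
    (hx₀W : f x₀ ∈ W) {r : ℕ} {a : Fin r → ∀ y : M, GenTan E y}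
    (ha : ∀ i, SmoothGenSectionOn (a i) Set.univ)
    (haL : ∀ y ∈ W, LinearIndependent ℝ (fun i => a i y) ∧
      Submodule.span ℝ (Set.range fun i => a i y) = L y) :
    ∃ U : Set B, IsOpen U ∧ x₀ ∈ U ∧ Set.MapsTo f U W ∧
      ∃ (n : ℕ) (s : Fin n → ∀ x : B, GenTan E' x) (g : Fin n → Fin r → B → ℝ),
        (∀ k, SmoothGenSectionOn (s k) U) ∧
        (∀ k i, ContMDiffOn 𝓘(ℝ, E') 𝓘(ℝ, ℝ) ∞ (g k i) U) ∧
        ∀ x ∈ U, (∀ k, pushforward f x (s k x).1 = ∑ i, g k i x • (a i (f x)).1 ∧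
            (s k x).2 = (∑ i, g k i x • (a i (f x)).2).comp (pushforward f x)) ∧
          LinearIndependent ℝ (fun k => s k x) ∧
          Submodule.span ℝ (Set.range fun k => s k x) = diracPullback (E' := E') f L x := by
  obtain ⟨d, hd⟩ := hsmooth
  set y₀ := f x₀ with hy₀
  set U₀ := (chartAt E' x₀).source ∩ f ⁻¹' ((chartAt E y₀).source ∩ W) with hU₀
  have hU₀o : IsOpen U₀ := (chartAt E' x₀).open_source.inter
    (((chartAt E y₀).open_source.inter hW).preimage hf.continuous)
  have hx₀U₀ : x₀ ∈ U₀ := ⟨mem_chart_source E' x₀, mem_chart_source E y₀, hx₀W⟩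
  have hmaps : Set.MapsTo f U₀ (chartAt E y₀).source := fun x hx => hx.2.1
  let D : B → E' →L[ℝ] E := fun x => (toModel (E := E) y₀ (f x)).comp
    ((pushforward (E := E) (E' := E') f x).comp (ofModel (E := E') x₀ x))
  have hD : ContMDiffOn 𝓘(ℝ, E') 𝓘(ℝ, E' →L[ℝ] E) ∞ D U₀ :=
    contMDiffOn_pushforward_coord hf Set.inter_subset_left hmaps
  let Y : Fin r → B → E := fun i x => toModel y₀ (f x) (a i (f x)).1
  let η : Fin r → B → E →L[ℝ] ℝ := fun i x => covectorToModel y₀ (f x) (a i (f x)).2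
  have hY : ∀ i, ContMDiffOn 𝓘(ℝ, E') 𝓘(ℝ, E) ∞ (Y i) U₀ := fun i =>
    ((contMDiffOn_vector_iff hmaps _).1
      ((contMDiffOn_univ.1 (ha i).1).comp_contMDiffOn hf.contMDiffOn)).2
  have hη : ∀ i, ContMDiffOn 𝓘(ℝ, E') 𝓘(ℝ, E →L[ℝ] ℝ) ∞ (η i) U₀ := fun i =>
    ((contMDiffOn_covector_iff hmaps _).1
      ((contMDiffOn_univ.1 (ha i).2).comp_contMDiffOn hf.contMDiffOn)).2
  -- In the frame `a` and the charts, `f^! L` is the kernel of `A`, and `Φ` induces its projection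
  -- `(a, X) ↦ (X, f^* pr_{T*M} a)` onto `𝔅L`.
  let p : Fin r → ((Fin r → ℝ) × E') →L[ℝ] ℝ := fun i =>
    (ContinuousLinearMap.proj i).comp (ContinuousLinearMap.fst ℝ (Fin r → ℝ) E')
  let A : B → ((Fin r → ℝ) × E') →L[ℝ] E := fun x =>
    (∑ i, ContinuousLinearMap.smulRightL ℝ _ E (p i) (Y i x))
      - (D x).comp (ContinuousLinearMap.snd ℝ (Fin r → ℝ) E')
  let Φ : B → ((Fin r → ℝ) × E') →L[ℝ] E' × (E' →L[ℝ] ℝ) := fun x =>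
    (ContinuousLinearMap.inl ℝ E' (E' →L[ℝ] ℝ)).comp
        (ContinuousLinearMap.snd ℝ (Fin r → ℝ) E') +
      (ContinuousLinearMap.inr ℝ E' (E' →L[ℝ] ℝ)).comp
        (∑ i, ContinuousLinearMap.smulRightL ℝ _ (E' →L[ℝ] ℝ) (p i) ((η i x).comp (D x)))
  have hA : ContMDiffOn 𝓘(ℝ, E') 𝓘(ℝ, ((Fin r → ℝ) × E') →L[ℝ] E) ∞ A U₀ :=
    (contMDiffOn_finsetSum fun i _ => contMDiffOn_const.clm_apply (hY i)).sub
      (hD.clm_comp contMDiffOn_const)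
  have hΦ : ContMDiffOn 𝓘(ℝ, E')
      𝓘(ℝ, ((Fin r → ℝ) × E') →L[ℝ] E' × (E' →L[ℝ] ℝ)) ∞ Φ U₀ :=
    contMDiffOn_const.add (contMDiffOn_const.clm_comp
      (contMDiffOn_finsetSum fun i _ => contMDiffOn_const.clm_apply ((hη i).clm_comp hD)))
  have hAapp : ∀ x g v, A x (g, v) = ∑ i, g i • Y i x - D x v := fun x g v => by
    simp [A, p]
  have hΦapp : ∀ x g v, Φ x (g, v) = (v, ∑ i, g i • (η i x).comp (D x)) := fun x g v => by
    refine Prod.ext ?_ ?_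
    · simp [Φ, p, Prod.fst_sum]
    · simp [Φ, p, Prod.snd_sum]
  have hker : ∀ x ∈ U₀, ∀ g v, A x (g, v) = 0 ↔
      pushforward f x (ofModel x₀ x v) = ∑ i, g i • (a i (f x)).1 := by
    intro x hx g v
    rw [hAapp, sub_eq_zero]
    have h1 : ∑ i, g i • Y i x = toModel y₀ (f x) (∑ i, g i • (a i (f x)).1) := by
      rw [map_sum]
      simp only [map_smul]
      rfl
    rw [h1]
    constructor
    · intro h
      have := congrArg (ofModel y₀ (f x)) h
      rw [ofModel_toModel (hmaps hx)] at this
      rw [this]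
      exact (ofModel_toModel (hmaps hx) _).symm
    · intro h
      rw [← h]
      rfl
  have hcov : ∀ x (hx : x ∈ U₀) (g : Fin r → ℝ),
      ∑ i, g i • (η i x).comp (D x) =
        covectorToModel x₀ x ((∑ i, g i • (a i (f x)).2).comp (pushforward f x)) := by
    intro x hx g
    ext v
    have h1 : ∀ i, η i x (D x v) = (a i (f x)).2 (pushforward f x (ofModel x₀ x v)) := fun i =>
      congrArg (a i (f x)).2 (ofModel_toModel (hmaps hx) _)
    have h2 : ∀ w : Tan E (f x), (∑ i, g i • (a i (f x)).2) w = ∑ i, g i * (a i (f x)).2 w := by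
      intro w
      rw [sum_apply]
      rfl
    refine Eq.trans ?_ (h2 _).symm
    rw [sum_apply]
    exact Finset.sum_congr rfl fun i _ => congrArg (g i * ·) (h1 i)
  have hΦgen : ∀ x (hx : x ∈ U₀) (g : Fin r → ℝ) v, Φ x (g, v) = genToModel hx.1
      (ofModel x₀ x v, (∑ i, g i • (a i (f x)).2).comp (pushforward f x)) := by
    intro x hx g v
    rw [hΦapp, hcov x hx, genToModel_apply]
    exact Prod.ext (toModel_ofModel hx.1 v).symm rfl
  have hspan : ∀ x ∈ U₀, ∀ α : GenTan E (f x), α ∈ L (f x) ↔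
      ∃ g : Fin r → ℝ, ∑ i, g i • a i (f x) = α := by
    intro x hx α
    rw [← (haL (f x) hx.2.2).2, Submodule.mem_span_range_iff_exists_fun]
  have hsumeq : ∀ x (g : Fin r → ℝ), ∑ i, g i • a i (f x) =
      (∑ i, g i • (a i (f x)).1, ∑ i, g i • (a i (f x)).2) := by
    intro x g
    refine Prod.ext ?_ ?_
    · rw [Prod.fst_sum]
      rfl
    · rw [Prod.snd_sum]
      rfl
  have hkerd : ∀ x ∈ U₀,
      Module.finrank ℝ (LinearMap.ker (A x : ((Fin r → ℝ) × E') →ₗ[ℝ] E)) = d := by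
    intro x hx
    rw [← hd x]
    let comb : (Fin r → ℝ) →ₗ[ℝ] GenTan E (f x) := Fintype.linearCombination ℝ (fun i => a i (f x))
    have hcomb : ∀ g, comb g = ∑ i, g i • a i (f x) := fun g => rfl
    let F := (comb.prodMap (ofModel x₀ x).toLinearMap).restrict
      (p := LinearMap.ker (A x : ((Fin r → ℝ) × E') →ₗ[ℝ] E))
      (q := algebroidPullback (E' := E') f L x) (by
        rintro ⟨g, v⟩ hgv
        refine ⟨(hspan x hx _).2 ⟨g, rfl⟩, ?_⟩
        refine Eq.trans ?_ ((hker x hx g v).1 hgv).symm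
        exact congrArg Prod.fst (hsumeq x g))
    refine (LinearEquiv.ofBijective F ⟨?_, ?_⟩).finrank_eq
    · rintro ⟨⟨g, v⟩, h⟩ ⟨⟨g', v'⟩, h'⟩ heq
      have h1 := congrArg Subtype.val heq
      have h2 : comb g = comb g' := congrArg Prod.fst h1
      have h3 : ofModel x₀ x v = ofModel x₀ x v' := congrArg Prod.snd h1
      have h4 := congrArg (toModel x₀ x) h3
      rw [toModel_ofModel hx.1, toModel_ofModel hx.1] at h4
      have h5 : g = g' :=
        (linearIndependent_iff_injective_fintypeLinearCombination.1 (haL (f x) hx.2.2).1) h2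
      subst h4 h5
      rfl
    · rintro ⟨⟨α, X⟩, hα, hX⟩
      obtain ⟨g, rfl⟩ := (hspan x hx α).1 hα
      have h1 : ofModel x₀ x (toModel x₀ x X) = X := ofModel_toModel hx.1 X
      refine ⟨⟨(g, toModel x₀ x X), ?_⟩, Subtype.ext (Prod.ext rfl h1)⟩
      refine (hker x hx _ _).2 ?_
      rw [h1]
      exact hX.symm.trans (congrArg Prod.fst (hsumeq x g))
  have hmap : ∀ x (hx : x ∈ U₀), (LinearMap.ker (A x : ((Fin r → ℝ) × E') →ₗ[ℝ] E)).map
      (Φ x : ((Fin r → ℝ) × E') →ₗ[ℝ] E' × (E' →L[ℝ] ℝ)) =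
        (diracPullback (E' := E') f L x).map (genToModel hx.1).toLinearMap := by
    intro x hx
    ext ζ
    constructor
    · rintro ⟨⟨g, v⟩, hgv, rfl⟩
      refine ⟨_, ?_, (hΦgen x hx g v).symm⟩
      refine ⟨∑ i, g i • (a i (f x)).2, (hspan x hx _).2 ⟨g, ?_⟩, rfl⟩
      rw [hsumeq]
      exact Prod.ext ((hker x hx g v).1 hgv).symm rfl
    · rintro ⟨⟨X, _⟩, ⟨η', h1, rfl⟩, rfl⟩
      obtain ⟨g, hg⟩ := (hspan x hx _).1 h1
      rw [hsumeq] at hg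
      have h2 : ofModel x₀ x (toModel x₀ x X) = X := ofModel_toModel hx.1 X
      refine ⟨(g, toModel x₀ x X), (hker x hx _ _).2 ?_, ?_⟩
      · rw [h2]
        exact (congrArg Prod.fst hg).symm
      · refine (hΦgen x hx g _).trans ?_
        rw [h2, show ∑ i, g i • (a i (f x)).2 = η' from congrArg Prod.snd hg]
        rfl
  obtain ⟨U₁, hU₁, hU₁o, hx₁, K, P, hP, hPker⟩ :=
    exists_smooth_parametrization_ker hU₀o hx₀U₀ hA hkerd
  let N : B → K →L[ℝ] E' × (E' →L[ℝ] ℝ) := fun x => (Φ x).comp (P x)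
  have hN : ContMDiffOn 𝓘(ℝ, E') 𝓘(ℝ, K →L[ℝ] E' × (E' →L[ℝ] ℝ)) ∞ N U₁ :=
    (hΦ.mono hU₁).clm_comp hP
  have hNrange : ∀ x (hx : x ∈ U₁), LinearMap.range (N x : K →ₗ[ℝ] E' × (E' →L[ℝ] ℝ)) =
      (diracPullback (E' := E') f L x).map (genToModel (hU₁ hx).1).toLinearMap := by
    intro x hx
    rw [← hmap x (hU₁ hx), ← (hPker x hx).2, ← LinearMap.range_comp]
    rfl
  have hNd : ∀ x ∈ U₁, Module.finrank ℝ (LinearMap.range (N x : K →ₗ[ℝ] E' × (E' →L[ℝ] ℝ)))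
      = Module.finrank ℝ E' := by
    intro x hx
    rw [hNrange x hx, LinearEquiv.finrank_map_eq, finrank_diracPullback f hL]
  obtain ⟨U₂, hU₂, hU₂o, hx₂, K', hK'⟩ := exists_subspace_injective_range hU₁o hx₁ hN hNd
  let b := Module.finBasis ℝ K'
  let q : Fin _ → B → (Fin r → ℝ) × E' := fun k x => P x (b k)
  have hq : ∀ k, ContMDiffOn 𝓘(ℝ, E') 𝓘(ℝ, (Fin r → ℝ) × E') ∞ (q k) U₂ := fun k =>
    (hP.mono hU₂).clm_apply contMDiffOn_const
  let s : Fin (Module.finrank ℝ K') → ∀ x : B, GenTan E' x := fun k x =>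
    (ofModel x₀ x (q k x).2, (∑ i, (q k x).1 i • (a i (f x)).2).comp (pushforward f x))
  have hs : ∀ k x (hx : x ∈ U₂), genToModel (hU₁ (hU₂ hx)).1 (s k x) = N x (b k) := by
    intro k x hx
    exact (hΦgen x (hU₁ (hU₂ hx)) _ _).symm
  refine ⟨U₂, hU₂o, hx₂, fun x hx => (hU₁ (hU₂ hx)).2.2, _, s, fun k i x => (q k x).1 i,
    fun k => ?_, fun k i => ?_, fun x hx => ⟨fun k => ⟨?_, rfl⟩, ?_, ?_⟩⟩
  · refine (smoothGenSectionOn_iff (fun x hx => (hU₁ (hU₂ hx)).1) _).2 ?_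
    refine ((hN.mono hU₂).clm_apply (contMDiffOn_const (c := (b k : K)))).congr fun x hx => ?_
    rw [← hs k x hx]
    rfl
  · exact ((ContinuousLinearMap.proj (R := ℝ) (φ := fun _ : Fin r => ℝ) i).comp
      (ContinuousLinearMap.fst ℝ (Fin r → ℝ) E')).contMDiff.comp_contMDiffOn (hq k)
  · refine (hker x (hU₁ (hU₂ hx)) _ _).1 ?_
    change P x (b k) ∈ LinearMap.ker (A x : ((Fin r → ℝ) × E') →ₗ[ℝ] E)
    rw [← (hPker x (hU₂ hx)).2]
    exact ⟨_, rfl⟩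
  · refine LinearIndependent.of_comp (genToModel (hU₁ (hU₂ hx)).1).toLinearMap ?_
    have h1 := b.linearIndependent.map' ((N x).comp K'.subtypeL).toLinearMap
      (LinearMap.ker_eq_bot.2 (hK' x hx).1)
    convert! h1 using 1
    exact funext fun k => hs k x hx
  · refine Submodule.map_injective_of_injective
      (f := (genToModel (hU₁ (hU₂ hx)).1).toLinearMap) (genToModel (hU₁ (hU₂ hx)).1).injective ?_
    rw [← hNrange x (hU₂ hx), ← (hK' x hx).2, Submodule.map_span, ← Set.range_comp,
      LinearMap.range_eq_map, ← b.span_eq, Submodule.map_span, ← Set.range_comp]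
    congr 2
    exact funext fun k => hs k x hx

end LocalFrame

/-! ### The Courant bracket on a vector space -/

section ModelSpace

open Filter Topology

variable {E : Type*} [NormedAddCommGroup E] [NormedSpace ℝ E]
  {E' : Type*} [NormedAddCommGroup E'] [NormedSpace ℝ E']

/-- The pairing of the Courant bracket of `(X, ξ)` and `(X', ξ')` at the point `e` of a vector
space with `(v, ζ)`. The derivative of `ξ'` in the direction `v` occurs twice in
`d(ξ'(X)) + ι_X dξ'`, with opposite signs, so it is absent from the formula. -/
def courantForm (X : E → E) (ξ : E → E →L[ℝ] ℝ) (X' : E → E) (ξ' : E → E →L[ℝ] ℝ) (e v : E)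
    (ζ : E →L[ℝ] ℝ) : ℝ :=
  ζ (fderiv ℝ X' e (X e) - fderiv ℝ X e (X' e)) + ξ' e (fderiv ℝ X e v)
    + fderiv ℝ ξ' e (X e) v - fderiv ℝ ξ e (X' e) v + fderiv ℝ ξ e v (X' e)

variable {ι : Type*} [Fintype ι]

/-- The relation `F_* X = ∑ gᵢ Yᵢ ∘ F`, differentiated in the direction `w` and solved for the term
that contains the derivative of `X`. -/
theorem fderiv_apply_fderiv_of_related {F : E' → E} {e₀ : E'} (hF : ContDiffAt ℝ 2 F e₀)
    {X : E' → E'} (hX : DifferentiableAt ℝ X e₀) {g : ι → E' → ℝ}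
    (hg : ∀ i, DifferentiableAt ℝ (g i) e₀) {Y : ι → E → E}
    (hY : ∀ i, DifferentiableAt ℝ (Y i) (F e₀))
    (hXY : ∀ᶠ e in 𝓝 e₀, fderiv ℝ F e (X e) = ∑ i, g i e • Y i (F e)) (w : E') :
    fderiv ℝ F e₀ (fderiv ℝ X e₀ w) = ∑ i, fderiv ℝ (g i) e₀ w • Y i (F e₀)
      + ∑ i, g i e₀ • fderiv ℝ (Y i) (F e₀) (fderiv ℝ F e₀ w)
      - fderiv ℝ (fderiv ℝ F) e₀ w (X e₀) := by
  have hF1 : DifferentiableAt ℝ F e₀ := hF.differentiableAt (by norm_num)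
  have hF2 : DifferentiableAt ℝ (fderiv ℝ F) e₀ :=
    (hF.fderiv_right (m := 1) (by norm_num)).differentiableAt (by norm_num)
  have h1 := (hF2.hasFDerivAt.clm_apply hX.hasFDerivAt).fderiv
  have h2 := (HasFDerivAt.fun_sum (u := Finset.univ) fun i _ =>
    (hg i).hasFDerivAt.fun_smul ((hY i).hasFDerivAt.comp e₀ hF1.hasFDerivAt)).fderiv
  have h3 := congrArg (fun T : E' →L[ℝ] E => T w)
    (h1.symm.trans ((Filter.EventuallyEq.fderiv_eq hXY).trans h2))
  simp only [add_apply, sum_apply, smul_apply, ContinuousLinearMap.comp_apply,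
    ContinuousLinearMap.flip_apply, ContinuousLinearMap.smulRight_apply, Function.comp_apply,
    Finset.sum_add_distrib] at h3
  rw [eq_sub_iff_add_eq, h3, add_comm]

/-- The derivative of the one-form `ξ = ∑ gᵢ F^* ηᵢ`. -/
theorem fderiv_of_eventuallyEq_pullback {F : E' → E} {e₀ : E'} (hF : ContDiffAt ℝ 2 F e₀)
    {ξ : E' → E' →L[ℝ] ℝ} {g : ι → E' → ℝ}
    (hg : ∀ i, DifferentiableAt ℝ (g i) e₀) {η : ι → E → E →L[ℝ] ℝ}
    (hη : ∀ i, DifferentiableAt ℝ (η i) (F e₀))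
    (hξ : ∀ᶠ e in 𝓝 e₀, ξ e = (∑ i, g i e • η i (F e)).comp (fderiv ℝ F e)) (w u : E') :
    fderiv ℝ ξ e₀ w u = (∑ i, fderiv ℝ (g i) e₀ w • η i (F e₀)) (fderiv ℝ F e₀ u)
      + ∑ i, g i e₀ • fderiv ℝ (η i) (F e₀) (fderiv ℝ F e₀ w) (fderiv ℝ F e₀ u)
      + (∑ i, g i e₀ • η i (F e₀)) (fderiv ℝ (fderiv ℝ F) e₀ w u) := by
  have hF1 : DifferentiableAt ℝ F e₀ := hF.differentiableAt (by norm_num)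
  have hF2 : DifferentiableAt ℝ (fderiv ℝ F) e₀ :=
    (hF.fderiv_right (m := 1) (by norm_num)).differentiableAt (by norm_num)
  have h2 := ((HasFDerivAt.fun_sum (u := Finset.univ) fun i _ =>
    (hg i).hasFDerivAt.fun_smul ((hη i).hasFDerivAt.comp e₀ hF1.hasFDerivAt)).clm_comp
      hF2.hasFDerivAt).fderiv
  have h3 := congrArg (fun T : E' →L[ℝ] E' →L[ℝ] ℝ => T w u)
    ((Filter.EventuallyEq.fderiv_eq hξ).trans h2)
  simp only [add_apply, sum_apply, smul_apply, ContinuousLinearMap.comp_apply,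
    ContinuousLinearMap.flip_apply, ContinuousLinearMap.smulRight_apply, Function.comp_apply,
    Finset.sum_add_distrib, ContinuousLinearMap.compL_apply] at h3 ⊢
  rw [h3]
  ring

/-- Naturality of the pairing with a Courant bracket. Let `(X, ξ)` and `(X', ξ')` be related by `F`
to the combinations `∑ gᵢ (Yᵢ, ηᵢ)` and `∑ g'ᵢ (Yᵢ, ηᵢ)` with non-constant coefficients. In the
bracket on the target the coefficients can be frozen at `e₀`: their derivatives do not contribute,
because the `(Yᵢ, ηᵢ)` and `(w, β)` span an isotropic subspace, and the second derivatives of `F`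
cancel by symmetry. -/
theorem courantForm_pullback {F : E' → E} {e₀ : E'} (hF : ContDiffAt ℝ 2 F e₀)
    {X X' : E' → E'} (hX : DifferentiableAt ℝ X e₀) (hX' : DifferentiableAt ℝ X' e₀)
    {g g' : ι → E' → ℝ} (hg : ∀ i, DifferentiableAt ℝ (g i) e₀)
    (hg' : ∀ i, DifferentiableAt ℝ (g' i) e₀)
    {Y : ι → E → E} (hY : ∀ i, DifferentiableAt ℝ (Y i) (F e₀))
    {η : ι → E → E →L[ℝ] ℝ} (hη : ∀ i, DifferentiableAt ℝ (η i) (F e₀))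
    (hXY : ∀ᶠ e in 𝓝 e₀, fderiv ℝ F e (X e) = ∑ i, g i e • Y i (F e))
    (hXY' : ∀ᶠ e in 𝓝 e₀, fderiv ℝ F e (X' e) = ∑ i, g' i e • Y i (F e))
    {ξ ξ' : E' → E' →L[ℝ] ℝ}
    (hξ : ∀ᶠ e in 𝓝 e₀, ξ e = (∑ i, g i e • η i (F e)).comp (fderiv ℝ F e))
    (hξ' : ∀ᶠ e in 𝓝 e₀, ξ' e = (∑ i, g' i e • η i (F e)).comp (fderiv ℝ F e))
    {v : E'} {w : E} (hv : fderiv ℝ F e₀ v = w) {β : E →L[ℝ] ℝ}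
    (hβ : ∀ p : ι → ℝ, β (∑ i, p i • Y i (F e₀)) + (∑ i, p i • η i (F e₀)) w = 0)
    (hiso : ∀ p q : ι → ℝ, (∑ i, p i • η i (F e₀)) (∑ i, q i • Y i (F e₀))
      + (∑ i, q i • η i (F e₀)) (∑ i, p i • Y i (F e₀)) = 0) :
    courantForm X ξ X' ξ' e₀ v (β.comp (fderiv ℝ F e₀)) =
      courantForm (fun y => ∑ i, g i e₀ • Y i y) (fun y => ∑ i, g i e₀ • η i y)
        (fun y => ∑ i, g' i e₀ • Y i y) (fun y => ∑ i, g' i e₀ • η i y) (F e₀) w β := by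
  have hsymm : ∀ a b, fderiv ℝ (fderiv ℝ F) e₀ a b = fderiv ℝ (fderiv ℝ F) e₀ b a := fun a b =>
    hF.isSymmSndFDerivAt (by simp) a b
  have hsumY : ∀ (p : ι → ℝ) (a : E), fderiv ℝ (fun y => ∑ i, p i • Y i y) (F e₀) a
      = ∑ i, p i • fderiv ℝ (Y i) (F e₀) a := fun p a => by
    rw [(HasFDerivAt.fun_sum (u := Finset.univ) fun i _ =>
      (hY i).hasFDerivAt.fun_const_smul (p i)).fderiv]
    simp
  have hsumη : ∀ (p : ι → ℝ) (a b : E), fderiv ℝ (fun y => ∑ i, p i • η i y) (F e₀) a b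
      = ∑ i, p i • fderiv ℝ (η i) (F e₀) a b := fun p a b => by
    rw [(HasFDerivAt.fun_sum (u := Finset.univ) fun i _ =>
      (hη i).hasFDerivAt.fun_const_smul (p i)).fderiv]
    simp
  have hDX := fderiv_apply_fderiv_of_related hF hX hg hY hXY
  have hDX' := fderiv_apply_fderiv_of_related hF hX' hg' hY hXY'
  have hDξ := fderiv_of_eventuallyEq_pullback hF hg hη hξ
  have hDξ' := fderiv_of_eventuallyEq_pullback hF hg' hη hξ'
  have hX0 := hXY.self_of_nhds
  have hX0' := hXY'.self_of_nhds
  have hξ0' := hξ'.self_of_nhds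
  -- the three isotropy relations that remove the derivatives of the coefficients
  have i1 := hβ fun i => fderiv ℝ (g' i) e₀ (X e₀)
  have i2 := hβ fun i => fderiv ℝ (g i) e₀ (X' e₀)
  have i3 := hiso (fun i => fderiv ℝ (g i) e₀ v) fun i => g' i e₀
  rw [courantForm, courantForm]
  simp only [hsumY, hsumη, hξ0', hDξ, hDξ', ContinuousLinearMap.comp_apply, map_sub, hDX, hDX',
    hv, hX0, hX0', map_add, hsymm v (X e₀), hsymm (X' e₀) (X e₀), hsymm (X' e₀) v]
  linarith

end ModelSpace

/-! ### Brackets in a chart -/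

section Charts

open Filter Topology

variable {E : Type*} [NormedAddCommGroup E] [NormedSpace ℝ E]
  {M : Type*} [TopologicalSpace M] [ChartedSpace E M] [IsManifold 𝓘(ℝ, E) ∞ M]

/-- The expression of a vector field in the preferred chart at `x₀`. -/
def vectorRep (X : ∀ x : M, Tan E x) (x₀ : M) (e : E) : E :=
  toModel x₀ ((extChartAt 𝓘(ℝ, E) x₀).symm e) (X ((extChartAt 𝓘(ℝ, E) x₀).symm e))

/-- The expression of a one-form in the preferred chart at `x₀`. -/
def covectorRep (ξ : ∀ x : M, Cotan E x) (x₀ : M) (e : E) : E →L[ℝ] ℝ :=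
  covectorToModel x₀ ((extChartAt 𝓘(ℝ, E) x₀).symm e) (ξ ((extChartAt 𝓘(ℝ, E) x₀).symm e))

theorem vectorRep_extChartAt (X : ∀ x : M, Tan E x) {x₀ x : M}
    (hx : x ∈ (chartAt E x₀).source) :
    vectorRep X x₀ (extChartAt 𝓘(ℝ, E) x₀ x) = toModel x₀ x (X x) := by
  have h : (extChartAt 𝓘(ℝ, E) x₀).symm (extChartAt 𝓘(ℝ, E) x₀ x) = x :=
    (extChartAt 𝓘(ℝ, E) x₀).left_inv (by rwa [extChartAt_source])
  exact congrArg (fun y => toModel x₀ y (X y)) h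

theorem covectorRep_extChartAt (ξ : ∀ x : M, Cotan E x) {x₀ x : M}
    (hx : x ∈ (chartAt E x₀).source) :
    covectorRep ξ x₀ (extChartAt 𝓘(ℝ, E) x₀ x) = covectorToModel x₀ x (ξ x) := by
  have h : (extChartAt 𝓘(ℝ, E) x₀).symm (extChartAt 𝓘(ℝ, E) x₀ x) = x :=
    (extChartAt 𝓘(ℝ, E) x₀).left_inv (by rwa [extChartAt_source])
  exact congrArg (fun y => covectorToModel x₀ y (ξ y)) h

theorem toModel_eq_mfderiv {x₀ x : M} (hx : x ∈ (chartAt E x₀).source) :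
    toModel x₀ x = mfderiv 𝓘(ℝ, E) 𝓘(ℝ, E) (extChartAt 𝓘(ℝ, E) x₀) x :=
  TangentBundle.continuousLinearMapAt_trivializationAt hx

theorem ofModel_eq_mfderiv {x₀ : M} {e : E} (he : e ∈ (extChartAt 𝓘(ℝ, E) x₀).target) :
    ofModel (E := E) x₀ ((extChartAt 𝓘(ℝ, E) x₀).symm e) =
      mfderiv 𝓘(ℝ, E) 𝓘(ℝ, E) (extChartAt 𝓘(ℝ, E) x₀).symm e := by
  have hx : (extChartAt 𝓘(ℝ, E) x₀).symm e ∈ (chartAt E x₀).source := by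
    rw [← extChartAt_source 𝓘(ℝ, E)]
    exact (extChartAt 𝓘(ℝ, E) x₀).map_target he
  have h := TangentBundle.symmL_trivializationAt (I := 𝓘(ℝ, E)) hx
  rw [modelWithCornersSelf_coe, Set.range_id, mfderivWithin_univ,
    (extChartAt 𝓘(ℝ, E) x₀).right_inv he] at h
  exact h

theorem oneFormInChart_eventuallyEq (ξ : ∀ x : M, Cotan E x) (x₀ : M) :
    oneFormInChart ξ x₀ =ᶠ[𝓝 (extChartAt 𝓘(ℝ, E) x₀ x₀)] covectorRep ξ x₀ := by
  filter_upwards [extChartAt_target_mem_nhds (I := 𝓘(ℝ, E)) x₀] with e he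
  rw [oneFormInChart, ← ofModel_eq_mfderiv he]
  rfl

theorem contractD_apply (ξ : ∀ x : M, Cotan E x) (x₀ : M) (v w : Tan E x₀) :
    evalCovector (contractD ξ x₀ v) w =
      fderiv ℝ (covectorRep ξ x₀) (extChartAt 𝓘(ℝ, E) x₀ x₀) (toModel x₀ x₀ v) (toModel x₀ x₀ w)
      - fderiv ℝ (covectorRep ξ x₀) (extChartAt 𝓘(ℝ, E) x₀ x₀) (toModel x₀ x₀ w)
        (toModel x₀ x₀ v) := by
  rw [evalCovector, contractD, (oneFormInChart_eventuallyEq ξ x₀).fderiv_eq,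
    ← toModel_eq_mfderiv (mem_chart_source E x₀)]
  rfl

theorem inverse_ofModel_apply {x₀ x : M} (hx : x ∈ (chartAt E x₀).source) (v : Tan E x) :
    (ofModel x₀ x).inverse v = toModel x₀ x v := by
  let T : E ≃L[ℝ] Tan E x := ContinuousLinearEquiv.equivOfInverse (ofModel x₀ x) (toModel x₀ x)
    (toModel_ofModel hx) (ofModel_toModel hx)
  have hT : ofModel x₀ x = (T : E →L[ℝ] Tan E x) := rfl
  rw [hT, ContinuousLinearMap.inverse_equiv]
  rfl

theorem inverse_toModel_apply {x₀ x : M} (hx : x ∈ (chartAt E x₀).source) (v : E) :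
    (toModel x₀ x).inverse v = ofModel x₀ x v := by
  let T : Tan E x ≃L[ℝ] E := ContinuousLinearEquiv.equivOfInverse (toModel x₀ x) (ofModel x₀ x)
    (ofModel_toModel hx) (toModel_ofModel hx)
  have hT : toModel x₀ x = (T : Tan E x →L[ℝ] E) := rfl
  rw [hT, ContinuousLinearMap.inverse_equiv]
  rfl

theorem mpullbackWithin_eventuallyEq (X : ∀ x : M, Tan E x) (x₀ : M) :
    VectorField.mpullbackWithin 𝓘(ℝ, E) 𝓘(ℝ, E) (extChartAt 𝓘(ℝ, E) x₀).symm X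
      (Set.range 𝓘(ℝ, E)) =ᶠ[𝓝 (extChartAt 𝓘(ℝ, E) x₀ x₀)] vectorRep X x₀ := by
  filter_upwards [extChartAt_target_mem_nhds (I := 𝓘(ℝ, E)) x₀] with e he
  have hx : (extChartAt 𝓘(ℝ, E) x₀).symm e ∈ (chartAt E x₀).source := by
    rw [← extChartAt_source 𝓘(ℝ, E)]
    exact (extChartAt 𝓘(ℝ, E) x₀).map_target he
  rw [VectorField.mpullbackWithin_apply, modelWithCornersSelf_coe, Set.range_id,
    mfderivWithin_univ, ← ofModel_eq_mfderiv he]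
  exact inverse_ofModel_apply hx _

/-- The Lie bracket in the preferred chart at the base point. -/
theorem toModel_mlieBracket (X Y : ∀ x : M, Tan E x) (x₀ : M) :
    toModel x₀ x₀ (VectorField.mlieBracket 𝓘(ℝ, E) X Y x₀) =
      fderiv ℝ (vectorRep Y x₀) (extChartAt 𝓘(ℝ, E) x₀ x₀) (toModel x₀ x₀ (X x₀))
      - fderiv ℝ (vectorRep X x₀) (extChartAt 𝓘(ℝ, E) x₀ x₀) (toModel x₀ x₀ (Y x₀)) := by
  have hx := mem_chart_source E x₀
  rw [← vectorRep_extChartAt X hx, ← vectorRep_extChartAt Y hx]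
  rw [← VectorField.mlieBracketWithin_univ, VectorField.mlieBracketWithin_apply,
    ← toModel_eq_mfderiv hx]
  have h : ∀ u : E, (toModel x₀ x₀) ((toModel x₀ x₀).inverse u) = u := by
    intro u
    rw [inverse_toModel_apply hx, toModel_ofModel hx]
  refine (h _).trans ?_
  rw [Set.preimage_univ, Set.univ_inter]
  have h3 : ∀ V W : E → E, V =ᶠ[𝓝 (extChartAt 𝓘(ℝ, E) x₀ x₀)] vectorRep X x₀ →
      W =ᶠ[𝓝 (extChartAt 𝓘(ℝ, E) x₀ x₀)] vectorRep Y x₀ →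
      VectorField.lieBracketWithin ℝ V W (Set.range 𝓘(ℝ, E)) (extChartAt 𝓘(ℝ, E) x₀ x₀) =
        VectorField.lieBracket ℝ (vectorRep X x₀) (vectorRep Y x₀)
          (extChartAt 𝓘(ℝ, E) x₀ x₀) := by
    intro V W h1 h2
    rw [modelWithCornersSelf_coe, Set.range_id, VectorField.lieBracketWithin_univ,
      h1.lieBracket_vectorField_eq h2]
  exact h3 _ _ (mpullbackWithin_eventuallyEq X x₀) (mpullbackWithin_eventuallyEq Y x₀)

theorem contDiffAt_comp_extChartAt_symm {F : Type*} [NormedAddCommGroup F] [NormedSpace ℝ F]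
    {u : M → F} {U : Set M} (hU : IsOpen U) {x₀ : M} (hx₀ : x₀ ∈ U)
    (hu : ContMDiffOn 𝓘(ℝ, E) 𝓘(ℝ, F) ∞ u U) :
    ContDiffAt ℝ ∞ (fun e => u ((extChartAt 𝓘(ℝ, E) x₀).symm e))
      (extChartAt 𝓘(ℝ, E) x₀ x₀) := by
  have h1 : ContMDiffAt 𝓘(ℝ, E) 𝓘(ℝ, E) ∞ (extChartAt 𝓘(ℝ, E) x₀).symm
      (extChartAt 𝓘(ℝ, E) x₀ x₀) :=
    (contMDiffOn_extChartAt_symm x₀).contMDiffAt (extChartAt_target_mem_nhds x₀)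
  have h2 : ContMDiffAt 𝓘(ℝ, E) 𝓘(ℝ, F) ∞ u
      ((extChartAt 𝓘(ℝ, E) x₀).symm (extChartAt 𝓘(ℝ, E) x₀ x₀)) := by
    rw [extChartAt_to_inv]
    exact hu.contMDiffAt (hU.mem_nhds hx₀)
  exact (h2.comp _ h1).contDiffAt

theorem contDiffAt_vectorRep {X : ∀ x : M, Tan E x} {U : Set M} (hU : IsOpen U) {x₀ : M}
    (hx₀ : x₀ ∈ U) (hX : SmoothVectorFieldOn X U) :
    ContDiffAt ℝ ∞ (vectorRep X x₀) (extChartAt 𝓘(ℝ, E) x₀ x₀) :=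
  contDiffAt_comp_extChartAt_symm (hU.inter (chartAt E x₀).open_source)
    ⟨hx₀, mem_chart_source E x₀⟩
    ((contMDiffOn_vector_iff (f := fun x => x) (y₀ := x₀) (fun _ hx => hx.2) _).1
      (ContMDiffOn.mono hX Set.inter_subset_left)).2

theorem contDiffAt_covectorRep {ξ : ∀ x : M, Cotan E x} {U : Set M} (hU : IsOpen U) {x₀ : M}
    (hx₀ : x₀ ∈ U) (hξ : SmoothOneFormOn ξ U) :
    ContDiffAt ℝ ∞ (covectorRep ξ x₀) (extChartAt 𝓘(ℝ, E) x₀ x₀) :=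
  contDiffAt_comp_extChartAt_symm (hU.inter (chartAt E x₀).open_source)
    ⟨hx₀, mem_chart_source E x₀⟩
    ((contMDiffOn_covector_iff (f := fun x => x) (y₀ := x₀) (fun _ hx => hx.2) _).1
      (ContMDiffOn.mono hξ Set.inter_subset_left)).2

theorem contMDiffOn_evalCovector {X : ∀ x : M, Tan E x} {ξ : ∀ x : M, Cotan E x} {U : Set M}
    (hξ : SmoothOneFormOn ξ U) (hX : SmoothVectorFieldOn X U) :
    ContMDiffOn 𝓘(ℝ, E) 𝓘(ℝ, ℝ) ∞ (fun x => evalCovector (ξ x) (X x)) U := by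
  have h := ContMDiffOn.clm_bundle_apply (E₁ := TangentSpace 𝓘(ℝ, E)) (E₂ := Bundle.Trivial M ℝ)
    hξ hX
  exact fun x hx => (Bundle.contMDiffWithinAt_totalSpace.1 (h x hx)).2

theorem evalCovector_toModel {x₀ x : M} (ξ : Cotan E x) (hx : x ∈ (chartAt E x₀).source)
    (v : Tan E x) : evalCovector ξ v = covectorToModel x₀ x ξ (toModel x₀ x v) :=
  (congrArg ξ (ofModel_toModel hx v)).symm

/-- The derivative of a function in the direction of a tangent vector, as a real number. -/
def dirDeriv (h : M → ℝ) (x : M) (v : Tan E x) : ℝ := mfderiv 𝓘(ℝ, E) 𝓘(ℝ, ℝ) h x v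

theorem dirDeriv_evalCovector {X : ∀ x : M, Tan E x} {ξ : ∀ x : M, Cotan E x} {U : Set M}
    (hU : IsOpen U) {x₀ : M} (hx₀ : x₀ ∈ U)
    (hξ : SmoothOneFormOn ξ U) (hX : SmoothVectorFieldOn X U) (w : Tan E x₀) :
    dirDeriv (fun y => evalCovector (ξ y) (X y)) x₀ w =
      fderiv ℝ (covectorRep ξ x₀) (extChartAt 𝓘(ℝ, E) x₀ x₀) (toModel x₀ x₀ w)
        (toModel x₀ x₀ (X x₀))
      + covectorRep ξ x₀ (extChartAt 𝓘(ℝ, E) x₀ x₀)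
        (fderiv ℝ (vectorRep X x₀) (extChartAt 𝓘(ℝ, E) x₀ x₀) (toModel x₀ x₀ w)) := by
  have hx := mem_chart_source E x₀
  set φ := extChartAt 𝓘(ℝ, E) x₀ with hφ
  have hdX : DifferentiableAt ℝ (vectorRep X x₀) (φ x₀) :=
    (contDiffAt_vectorRep hU hx₀ hX).differentiableAt (by simp)
  have hdξ : DifferentiableAt ℝ (covectorRep ξ x₀) (φ x₀) :=
    (contDiffAt_covectorRep hU hx₀ hξ).differentiableAt (by simp)
  have h1 : (fun y => evalCovector (ξ y) (X y)) =ᶠ[𝓝 x₀]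
      (fun e => covectorRep ξ x₀ e (vectorRep X x₀ e)) ∘ φ := by
    filter_upwards [(chartAt E x₀).open_source.mem_nhds hx] with y hy
    rw [Function.comp_apply, vectorRep_extChartAt X hy, covectorRep_extChartAt ξ hy]
    exact evalCovector_toModel (ξ y) hy (X y)
  have h2 := hdξ.hasFDerivAt.clm_apply hdX.hasFDerivAt
  have h3 : MDifferentiableAt 𝓘(ℝ, E) 𝓘(ℝ, E) φ x₀ :=
    mdifferentiableAt_extChartAt (by exact hx)
  rw [dirDeriv, h1.mfderiv_eq, mfderiv_comp x₀ h2.differentiableAt.mdifferentiableAt h3,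
    mfderiv_eq_fderiv, h2.fderiv, ← vectorRep_extChartAt X hx, hφ, toModel_eq_mfderiv hx]
  exact add_comm _ _

/-- The formula `dξ(X, Z) = X(ξ(Z)) - Z(ξ(X)) - ξ([X, Z])`. -/
theorem contractD_apply_eq {X Z : ∀ x : M, Tan E x} {ξ : ∀ x : M, Cotan E x} {U : Set M}
    (hU : IsOpen U) {x₀ : M} (hx₀ : x₀ ∈ U)
    (hξ : SmoothOneFormOn ξ U) (hX : SmoothVectorFieldOn X U) (hZ : SmoothVectorFieldOn Z U) :
    evalCovector (contractD ξ x₀ (X x₀)) (Z x₀) =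
      dirDeriv (fun y => evalCovector (ξ y) (Z y)) x₀ (X x₀)
      - dirDeriv (fun y => evalCovector (ξ y) (X y)) x₀ (Z x₀)
      - evalCovector (ξ x₀) (VectorField.mlieBracket 𝓘(ℝ, E) X Z x₀) := by
  have hx := mem_chart_source E x₀
  have h := evalCovector_toModel (ξ x₀) hx (VectorField.mlieBracket 𝓘(ℝ, E) X Z x₀)
  rw [contractD_apply, dirDeriv_evalCovector hU hx₀ hξ hZ, dirDeriv_evalCovector hU hx₀ hξ hX,
    h, toModel_mlieBracket, map_sub, covectorRep_extChartAt ξ hx]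
  ring

/-- The pairing with a Courant bracket is computed by `courantForm` in the preferred chart at the
base point. -/
theorem pairing_courantBracket {σ τ : ∀ x : M, GenTan E x} {U : Set M} (hU : IsOpen U) {x₀ : M}
    (hx₀ : x₀ ∈ U) (hσ : SmoothGenSectionOn σ U) (hτ : SmoothGenSectionOn τ U)
    (b : GenTan E x₀) :
    pairing (courantBracket σ τ x₀) b =
      courantForm (vectorRep (fun x => (σ x).1) x₀) (covectorRep (fun x => (σ x).2) x₀)
        (vectorRep (fun x => (τ x).1) x₀) (covectorRep (fun x => (τ x).2) x₀)
        (extChartAt 𝓘(ℝ, E) x₀ x₀) (toModel x₀ x₀ b.1) (covectorToModel x₀ x₀ b.2) := by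
  have hx := mem_chart_source E x₀
  have h1 : pairing (courantBracket σ τ x₀) b =
      dirDeriv (fun y => evalCovector (τ y).2 (σ y).1) x₀ b.1
        + evalCovector (contractD (fun y => (τ y).2) x₀ (σ x₀).1) b.1
        - evalCovector (contractD (fun y => (σ y).2) x₀ (τ x₀).1) b.1
        + evalCovector b.2
          (VectorField.mlieBracket 𝓘(ℝ, E) (fun y => (σ y).1) (fun y => (τ y).1) x₀) := rfl
  rw [h1, dirDeriv_evalCovector hU hx₀ hτ.2 hσ.1, contractD_apply, contractD_apply,
    evalCovector_toModel b.2 hx, toModel_mlieBracket, courantForm,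
    vectorRep_extChartAt _ hx, vectorRep_extChartAt _ hx]
  ring

end Charts

/-! ### Smoothness of the Courant bracket, and maps in charts -/

section BracketSmooth

variable {E : Type*} [NormedAddCommGroup E] [NormedSpace ℝ E]
  {M : Type*} [TopologicalSpace M] [ChartedSpace E M] [IsManifold 𝓘(ℝ, E) ∞ M]

theorem contMDiffOn_dirDeriv {U : Set M} (hU : IsOpen U) {h : M → ℝ}
    (hh : ContMDiffOn 𝓘(ℝ, E) 𝓘(ℝ, ℝ) ∞ h U) {X : ∀ x : M, Tan E x}
    (hX : SmoothVectorFieldOn X U) :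
    ContMDiffOn 𝓘(ℝ, E) 𝓘(ℝ, ℝ) ∞ (fun x => dirDeriv h x (X x)) U := by
  have h1 : ContMDiffOn (𝓘(ℝ, E).prod 𝓘(ℝ, E)) (𝓘(ℝ, ℝ).prod 𝓘(ℝ, ℝ)) ∞
      (tangentMapWithin 𝓘(ℝ, E) 𝓘(ℝ, ℝ) h U)
      (Bundle.TotalSpace.proj ⁻¹' U : Set (TangentBundle 𝓘(ℝ, E) M)) :=
    hh.contMDiffOn_tangentMapWithin (by simp) hU.uniqueMDiffOn
  have h2 := (contMDiff_snd_tangentBundle_modelSpace ℝ 𝓘(ℝ, ℝ)).comp_contMDiffOn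
    (h1.comp hX fun x hx => hx)
  refine h2.congr fun x hx => ?_
  change _ = (mfderivWithin 𝓘(ℝ, E) 𝓘(ℝ, ℝ) h U x) (X x)
  rw [mfderivWithin_of_isOpen hU hx]
  rfl

variable [FiniteDimensional ℝ E]

theorem contMDiffOn_mlieBracket {U : Set M} (hU : IsOpen U) {X Y : ∀ x : M, Tan E x}
    (hX : SmoothVectorFieldOn X U) (hY : SmoothVectorFieldOn Y U) :
    SmoothVectorFieldOn (fun x => VectorField.mlieBracket 𝓘(ℝ, E) X Y x) U := by
  have : CompleteSpace E := FiniteDimensional.complete ℝ E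
  have : IsManifold 𝓘(ℝ, E) (minSmoothness ℝ 2) M := by
    rw [minSmoothness_of_isRCLikeNormedField]
    infer_instance
  have : IsManifold 𝓘(ℝ, E) (((⊤ : ℕ∞) : WithTop ℕ∞) + 1) M := ‹IsManifold 𝓘(ℝ, E) ∞ M›
  intro x hx
  exact (ContMDiffAt.mlieBracket_vectorField (m := ⊤) (n := ⊤)
    (ContMDiffOn.contMDiffAt hX (hU.mem_nhds hx)) (ContMDiffOn.contMDiffAt hY (hU.mem_nhds hx))
    (by simp)).contMDiffWithinAt

/-- The Courant bracket of smooth sections is smooth. The covector component is tested on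
coordinate vector fields `Z` with the formula
`ι_Z ι_X dξ = X(ξ(Z)) - Z(ξ(X)) - ξ([X, Z])`. -/
theorem smoothGenSectionOn_courantBracket {σ τ : ∀ x : M, GenTan E x}
    (hσ : SmoothGenSectionOn σ Set.univ) (hτ : SmoothGenSectionOn τ Set.univ) :
    SmoothGenSectionOn (courantBracket σ τ) Set.univ := by
  refine ⟨contMDiffOn_mlieBracket isOpen_univ hσ.1 hτ.1, fun x₀ _ => ?_⟩
  have hS := (chartAt E x₀).open_source
  set S := (chartAt E x₀).source
  have hσ' := hσ.mono (Set.subset_univ S)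
  have hτ' := hτ.mono (Set.subset_univ S)
  suffices h : SmoothOneFormOn (fun x => (courantBracket σ τ x).2) S from
    (ContMDiffOn.contMDiffAt h (hS.mem_nhds (mem_chart_source E x₀))).contMDiffWithinAt
  refine (contMDiffOn_covector_iff (f := fun x => x) (y₀ := x₀) (fun _ hx => hx) _).2
    ⟨contMDiffOn_id, contMDiffOn_clm_of_apply fun v => ?_⟩
  have hZ := contMDiffOn_ofModel (M := M) x₀ v
  set Z : ∀ x : M, Tan E x := fun x => ofModel x₀ x v
  have hsm : ∀ {X : ∀ x : M, Tan E x} {ξ : ∀ x : M, Cotan E x}, SmoothVectorFieldOn X S →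
      SmoothOneFormOn ξ S → ContMDiffOn 𝓘(ℝ, E) 𝓘(ℝ, ℝ) ∞
        (fun x => dirDeriv (fun y => evalCovector (ξ y) (Z y)) x (X x)
          - dirDeriv (fun y => evalCovector (ξ y) (X y)) x (Z x)
          - evalCovector (ξ x) (VectorField.mlieBracket 𝓘(ℝ, E) X Z x)) S := fun hX hξ =>
    ((contMDiffOn_dirDeriv hS (contMDiffOn_evalCovector hξ hZ) hX).sub
      (contMDiffOn_dirDeriv hS (contMDiffOn_evalCovector hξ hX) hZ)).sub
      (contMDiffOn_evalCovector hξ (contMDiffOn_mlieBracket hS hX hZ))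
  refine (((contMDiffOn_dirDeriv hS (contMDiffOn_evalCovector hτ'.2 hσ'.1) hZ).add
    (hsm hσ'.1 hτ'.2)).sub (hsm hτ'.1 hσ'.2)).congr fun x hx => ?_
  rw [Pi.add_apply, ← contractD_apply_eq hS hx hτ'.2 hσ'.1 hZ,
    ← contractD_apply_eq hS hx hσ'.2 hτ'.1 hZ]
  rfl

end BracketSmooth

section ChartMap

open Filter Topology

variable {E : Type*} [NormedAddCommGroup E] [NormedSpace ℝ E]
  {M : Type*} [TopologicalSpace M] [ChartedSpace E M]
  {E' : Type*} [NormedAddCommGroup E'] [NormedSpace ℝ E']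
  {B : Type*} [TopologicalSpace B] [ChartedSpace E' B]

/-- The map `f` in the preferred charts at `x₀` and `f x₀`. -/
def chartRep (E E' : Type*) [NormedAddCommGroup E] [NormedSpace ℝ E] [NormedAddCommGroup E']
    [NormedSpace ℝ E'] {M : Type*} [TopologicalSpace M] [ChartedSpace E M] {B : Type*}
    [TopologicalSpace B] [ChartedSpace E' B] (f : B → M) (x₀ : B) (e : E') : E :=
  extChartAt 𝓘(ℝ, E) (f x₀) (f ((extChartAt 𝓘(ℝ, E') x₀).symm e))

theorem chartRep_extChartAt (f : B → M) {x₀ x : B} (hx : x ∈ (chartAt E' x₀).source) :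
    chartRep E E' f x₀ (extChartAt 𝓘(ℝ, E') x₀ x) = extChartAt 𝓘(ℝ, E) (f x₀) (f x) := by
  rw [chartRep, (extChartAt 𝓘(ℝ, E') x₀).left_inv (by rwa [extChartAt_source])]

variable [IsManifold 𝓘(ℝ, E) ∞ M]

theorem covectorToModel_sum_smul {ι : Type*} [Fintype ι] {x₀ x : M} (p : ι → ℝ)
    (η : ι → Cotan E x) :
    covectorToModel x₀ x (∑ i, p i • η i) = ∑ i, p i • covectorToModel x₀ x (η i) := by
  ext v
  have h : (∑ i, p i • η i) (ofModel x₀ x v) = ∑ i, (p i • η i) (ofModel x₀ x v) := by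
    rw [sum_apply]
  rw [sum_apply]
  exact h

variable [IsManifold 𝓘(ℝ, E') ∞ B]

theorem contDiffAt_chartRep {f : B → M} (hf : ContMDiff 𝓘(ℝ, E') 𝓘(ℝ, E) ∞ f) (x₀ : B) :
    ContDiffAt ℝ ∞ (chartRep E E' f x₀) (extChartAt 𝓘(ℝ, E') x₀ x₀) := by
  refine contDiffAt_comp_extChartAt_symm (U := f ⁻¹' (chartAt E (f x₀)).source)
    (u := fun x => extChartAt 𝓘(ℝ, E) (f x₀) (f x))
    ((chartAt E (f x₀)).open_source.preimage hf.continuous) (mem_chart_source E (f x₀)) ?_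
  exact contMDiffOn_extChartAt.comp hf.contMDiffOn fun _ hx => hx

/-- The derivative of `f` in charts is `f_*` in the coordinates of the trivializations. -/
theorem fderiv_chartRep_toModel {f : B → M} (hf : ContMDiff 𝓘(ℝ, E') 𝓘(ℝ, E) ∞ f) {x₀ x : B}
    (hx : x ∈ (chartAt E' x₀).source) (hfx : f x ∈ (chartAt E (f x₀)).source) (v : Tan E' x) :
    fderiv ℝ (chartRep E E' f x₀) (extChartAt 𝓘(ℝ, E') x₀ x) (toModel x₀ x v) =
      toModel (f x₀) (f x) (pushforward f x v) := by
  have h1 : MDifferentiableAt 𝓘(ℝ, E') 𝓘(ℝ, E') (extChartAt 𝓘(ℝ, E') x₀) x :=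
    mdifferentiableAt_extChartAt hx
  have h2 : MDifferentiableAt 𝓘(ℝ, E) 𝓘(ℝ, E) (extChartAt 𝓘(ℝ, E) (f x₀)) (f x) :=
    mdifferentiableAt_extChartAt hfx
  have h3 : MDifferentiableAt 𝓘(ℝ, E') 𝓘(ℝ, E) f x := hf.mdifferentiableAt (by simp)
  have h4 : chartRep E E' f x₀ ∘ extChartAt 𝓘(ℝ, E') x₀ =ᶠ[𝓝 x]
      extChartAt 𝓘(ℝ, E) (f x₀) ∘ f := by
    filter_upwards [(chartAt E' x₀).open_source.mem_nhds hx] with y hy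
    exact chartRep_extChartAt f hy
  have h5 : MDifferentiableAt 𝓘(ℝ, E') 𝓘(ℝ, E) (chartRep E E' f x₀)
      (extChartAt 𝓘(ℝ, E') x₀ x) := by
    have h6 : MDifferentiableAt 𝓘(ℝ, E') 𝓘(ℝ, E')
        (extChartAt 𝓘(ℝ, E') x₀).symm (extChartAt 𝓘(ℝ, E') x₀ x) := by
      have := (contMDiffOn_extChartAt_symm (I := 𝓘(ℝ, E')) (n := ∞) x₀).contMDiffAt
        (extChartAt_target_mem_nhds' (y := extChartAt 𝓘(ℝ, E') x₀ x)
          ((extChartAt 𝓘(ℝ, E') x₀).map_source (by rwa [extChartAt_source])))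
      exact this.mdifferentiableAt (by simp)
    have h7 : (extChartAt 𝓘(ℝ, E') x₀).symm (extChartAt 𝓘(ℝ, E') x₀ x) = x :=
      (extChartAt 𝓘(ℝ, E') x₀).left_inv (by rwa [extChartAt_source])
    refine MDifferentiableAt.comp (I' := 𝓘(ℝ, E')) (g := extChartAt 𝓘(ℝ, E) (f x₀) ∘ f) _ ?_ h6
    rw [h7]
    exact h2.comp x h3
  have h8 := h4.mfderiv_eq (I := 𝓘(ℝ, E')) (I' := 𝓘(ℝ, E))
  rw [mfderiv_comp x h5 h1, mfderiv_comp x h2 h3, mfderiv_eq_fderiv,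
    ← toModel_eq_mfderiv hx, ← toModel_eq_mfderiv hfx] at h8
  exact congrArg (fun T : Tan E' x →L[ℝ] E => T v) h8

theorem covectorToModel_comp_pushforward {f : B → M} (hf : ContMDiff 𝓘(ℝ, E') 𝓘(ℝ, E) ∞ f)
    {x₀ x : B} (hx : x ∈ (chartAt E' x₀).source) (hfx : f x ∈ (chartAt E (f x₀)).source)
    (η : Cotan E (f x)) :
    covectorToModel (E := E') x₀ x (η.comp (pushforward f x)) =
      (covectorToModel (f x₀) (f x) η).comp
        (fderiv ℝ (chartRep E E' f x₀) (extChartAt 𝓘(ℝ, E') x₀ x)) := by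
  ext v
  have h := fderiv_chartRep_toModel hf hx hfx (ofModel x₀ x v)
  rw [toModel_ofModel hx] at h
  rw [ContinuousLinearMap.comp_apply, h]
  exact evalCovector_toModel η hfx _

end ChartMap

/-! ### Involutivity of the pullback -/

theorem sum_smul_comp {V V' ι κ : Type*} [AddCommGroup V] [Module ℝ V] [TopologicalSpace V]
    [AddCommGroup V'] [Module ℝ V'] [TopologicalSpace V'] [Fintype ι] [Fintype κ]
    (c : κ → ℝ) (G : κ → ι → ℝ) (η : ι → V →L[ℝ] ℝ) (A : V' →L[ℝ] V) :
    ∑ k, c k • (∑ i, G k i • η i).comp A = (∑ i, (∑ k, c k * G k i) • η i).comp A := by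
  simp only [← ContinuousLinearMap.smul_comp, ← ContinuousLinearMap.finsetSum_comp,
    Finset.smul_sum, Finset.sum_smul, mul_smul]
  rw [Finset.sum_comm]

section Involutive

open Filter Topology

variable {E : Type*} [NormedAddCommGroup E] [NormedSpace ℝ E] [FiniteDimensional ℝ E]
  {M : Type*} [TopologicalSpace M] [ChartedSpace E M] [IsManifold 𝓘(ℝ, E) ∞ M]
  {E' : Type*} [NormedAddCommGroup E'] [NormedSpace ℝ E'] [FiniteDimensional ℝ E']
  {B : Type*} [TopologicalSpace B] [ChartedSpace E' B] [IsManifold 𝓘(ℝ, E') ∞ B]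

/-- Smooth sections of `𝔅L` lift locally to smooth sections of `f^! L`, expressed by their
coefficients in a frame of `L`. The lift is linear in the section, so it vanishes where the section
vanishes. -/
theorem exists_local_lift {f : B → M} (hf : ContMDiff 𝓘(ℝ, E') 𝓘(ℝ, E) ∞ f)
    {L : ∀ y : M, Submodule ℝ (GenTan E y)} (hL : ∀ y, Maximal IsIsotropic (L y))
    (hsmooth : AlgebroidPullbackSmooth (E' := E') f L) (x₀ : B) {W : Set M} (hW : IsOpen W)
    (hx₀W : f x₀ ∈ W) {r : ℕ} {a : Fin r → ∀ y : M, GenTan E y}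
    (ha : ∀ i, SmoothGenSectionOn (a i) Set.univ)
    (haL : ∀ y ∈ W, LinearIndependent ℝ (fun i => a i y) ∧
      Submodule.span ℝ (Set.range fun i => a i y) = L y) :
    ∃ U : Set B, IsOpen U ∧ x₀ ∈ U ∧
      ∀ σ : ∀ x : B, GenTan E' x, SmoothGenSectionOn σ U →
        (∀ x, σ x ∈ diracPullback (E' := E') f L x) →
        ∃ g : Fin r → B → ℝ, (∀ i, ContMDiffOn 𝓘(ℝ, E') 𝓘(ℝ, ℝ) ∞ (g i) U) ∧
          ∀ x ∈ U, pushforward f x (σ x).1 = ∑ i, g i x • (a i (f x)).1 ∧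
            (σ x).2 = (∑ i, g i x • (a i (f x)).2).comp (pushforward f x) ∧
            (σ x = 0 → ∀ i, g i x = 0) := by
  obtain ⟨U, hU, hx₀, -, n, s, G, hs, hG, hframe⟩ :=
    exists_local_frame hf hL hsmooth x₀ hW hx₀W ha haL
  refine ⟨U, hU, hx₀, fun σ hσ hσL => ?_⟩
  have hex : ∀ x, ∃ c : Fin n → ℝ, x ∈ U → ∑ k, c k • s k x = σ x := by
    intro x
    by_cases hx : x ∈ U
    · have h := hσL x
      rw [← (hframe x hx).2.2, Submodule.mem_span_range_iff_exists_fun] at h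
      obtain ⟨c, hc⟩ := h
      exact ⟨c, fun _ => hc⟩
    · exact ⟨0, fun h => absurd h hx⟩
  choose c hc using hex
  have hcs : ∀ k, ContMDiffOn 𝓘(ℝ, E') 𝓘(ℝ, ℝ) ∞ (fun x => c x k) U :=
    contMDiffOn_coeff hU hs (fun x hx => (hframe x hx).2.1) (hσ.congr hc)
  refine ⟨fun i x => ∑ k, c x k * G k i x,
    fun i => contMDiffOn_finsetSum fun k _ => (hcs k).mul (hG k i), fun x hx => ⟨?_, ?_, ?_⟩⟩
  · rw [← hc x hx, Prod.fst_sum, map_sum]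
    simp only [Prod.smul_fst, map_smul, ((hframe x hx).1 _).1, Finset.smul_sum, Finset.sum_smul,
      mul_smul]
    exact Finset.sum_comm
  · rw [← hc x hx, Prod.snd_sum]
    simp only [Prod.smul_snd, ((hframe x hx).1 _).2]
    exact sum_smul_comp _ _ _ _
  · intro h0 i
    have h1 := Fintype.linearIndependent_iff.1 (hframe x hx).2.1 (c x) ((hc x hx).trans h0)
    simp [h1]

/-- The Courant bracket of two sections of `𝔅L` takes its values in `𝔅L`. Since `𝔅L` is
Lagrangian, this is tested by pairing with elements of `𝔅L`, and the pairing is computed on `M`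
by `courantForm_pullback`. -/
theorem courantBracket_mem_diracPullback [T2Space M] [SecondCountableTopology M]
    {f : B → M} (hf : ContMDiff 𝓘(ℝ, E') 𝓘(ℝ, E) ∞ f)
    {L : ∀ y : M, Submodule ℝ (GenTan E y)} (hL : IsDirac L)
    (hsmooth : AlgebroidPullbackSmooth (E' := E') f L) {σ τ : ∀ x : B, GenTan E' x}
    (hσ : IsSmoothSection (diracPullback (E' := E') f L) σ)
    (hτ : IsSmoothSection (diracPullback (E' := E') f L) τ) (x₀ : B) :
    courantBracket σ τ x₀ ∈ diracPullback (E' := E') f L x₀ := by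
  refine mem_of_forall_pairing_eq_zero
    (maximal_isIsotropic_diracPullback f hL.maximal_isotropic x₀) ?_
  rintro ⟨v, _⟩ ⟨β, hβ, rfl⟩
  obtain ⟨W, hW, hx₀W, r, a, ha, haL⟩ := hL.smooth.exists_global_frame (f x₀)
  obtain ⟨U, hU, hx₀, hlift⟩ := exists_local_lift hf hL.maximal_isotropic hsmooth x₀ hW hx₀W
    (fun i => (ha i).1) haL
  obtain ⟨g, hg, hgσ⟩ := hlift σ (hσ.1.mono (Set.subset_univ U)) hσ.2
  obtain ⟨g', hg', hgτ⟩ := hlift τ (hτ.1.mono (Set.subset_univ U)) hτ.2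
  set ψ := (extChartAt 𝓘(ℝ, E') x₀).symm with hψ
  set e₀ := extChartAt 𝓘(ℝ, E') x₀ x₀ with he₀
  set F := chartRep E E' f x₀ with hF
  let Y : Fin r → E → E := fun i => vectorRep (fun y => (a i y).1) (f x₀)
  let η : Fin r → E → E →L[ℝ] ℝ := fun i => covectorRep (fun y => (a i y).2) (f x₀)
  have hx : x₀ ∈ (chartAt E' x₀).source := mem_chart_source E' x₀
  have hfx : f x₀ ∈ (chartAt E (f x₀)).source := mem_chart_source E (f x₀)
  have hψe₀ : ψ e₀ = x₀ := extChartAt_to_inv x₀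
  have hFe₀ : F e₀ = extChartAt 𝓘(ℝ, E) (f x₀) (f x₀) := chartRep_extChartAt f hx
  -- Near `e₀` every point is the image of a point `x` of `U` at which the charts are defined.
  have hnear : ∀ {P : E' → Prop}, (∀ x ∈ U, x ∈ (chartAt E' x₀).source →
      f x ∈ (chartAt E (f x₀)).source → P (extChartAt 𝓘(ℝ, E') x₀ x)) → ∀ᶠ e in 𝓝 e₀, P e := by
    intro P hP
    have h1 : ∀ᶠ x in 𝓝 (ψ e₀), x ∈ U ∧ f x ∈ (chartAt E (f x₀)).source := by
      rw [hψe₀]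
      exact Filter.inter_mem (hU.mem_nhds hx₀)
        (((chartAt E (f x₀)).open_source.preimage hf.continuous).mem_nhds hfx)
    have h2 : ContinuousAt ψ e₀ := continuousAt_extChartAt_symm x₀
    filter_upwards [h2.eventually h1, extChartAt_target_mem_nhds (I := 𝓘(ℝ, E')) x₀]
      with e he het
    have h3 := (extChartAt 𝓘(ℝ, E') x₀).map_target het
    rw [extChartAt_source] at h3
    have h4 := hP _ he.1 h3 he.2
    rwa [(extChartAt 𝓘(ℝ, E') x₀).right_inv het] at h4
  have hY : ∀ p : Fin r → ℝ, (fun y => ∑ i, p i • Y i y) =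
      vectorRep (fun y => (∑ i, p i • a i y).1) (f x₀) := by
    intro p
    funext y
    simp only [vectorRep, Prod.fst_sum, map_sum, Prod.smul_fst, map_smul]
    rfl
  have hη : ∀ p : Fin r → ℝ, (fun y => ∑ i, p i • η i y) =
      covectorRep (fun y => (∑ i, p i • a i y).2) (f x₀) := by
    intro p
    funext y
    simp only [covectorRep, Prod.snd_sum, Prod.smul_snd]
    exact (covectorToModel_sum_smul _ _).symm
  have hY0 : ∀ {x}, f x ∈ (chartAt E (f x₀)).source → ∀ p : Fin r → ℝ,
      ∑ i, p i • Y i (extChartAt 𝓘(ℝ, E) (f x₀) (f x)) =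
        toModel (f x₀) (f x) (∑ i, p i • a i (f x)).1 := by
    intro x hx p
    rw [← vectorRep_extChartAt (fun y => (∑ i, p i • a i y).1) hx, ← hY]
  have hη0 : ∀ {x}, f x ∈ (chartAt E (f x₀)).source → ∀ p : Fin r → ℝ,
      ∑ i, p i • η i (extChartAt 𝓘(ℝ, E) (f x₀) (f x)) =
        covectorToModel (f x₀) (f x) (∑ i, p i • a i (f x)).2 := by
    intro x hx p
    rw [← covectorRep_extChartAt (fun y => (∑ i, p i • a i y).2) hx, ← hη]
  have hamem : ∀ (p : Fin r → ℝ) y, ∑ i, p i • a i y ∈ L y := fun p y =>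
    Submodule.sum_mem _ fun i _ => Submodule.smul_mem _ _ ((ha i).2 y)
  have hpair : ∀ α α' : GenTan E (f x₀), α ∈ L (f x₀) → α' ∈ L (f x₀) →
      covectorToModel (f x₀) (f x₀) α.2 (toModel (f x₀) (f x₀) α'.1)
        + covectorToModel (f x₀) (f x₀) α'.2 (toModel (f x₀) (f x₀) α.1) = 0 := by
    intro α α' hα hα'
    rw [← evalCovector_toModel _ hfx, ← evalCovector_toModel _ hfx]
    exact (hL.maximal_isotropic (f x₀)).prop α hα α' hα'
  have hsec : ∀ p : Fin r → ℝ, IsSmoothSection L (fun y => ∑ i, p i • a i y) := fun p =>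
    ⟨SmoothGenSectionOn.sum_smul (fun i => (ha i).1) fun i => contMDiffOn_const, hamem p⟩
  have hrel : ∀ {ρ : ∀ x : B, GenTan E' x} {h : Fin r → B → ℝ},
      (∀ x ∈ U, pushforward f x (ρ x).1 = ∑ i, h i x • (a i (f x)).1 ∧
        (ρ x).2 = (∑ i, h i x • (a i (f x)).2).comp (pushforward f x) ∧
        (ρ x = 0 → ∀ i, h i x = 0)) →
      (∀ᶠ e in 𝓝 e₀, fderiv ℝ F e (vectorRep (fun x => (ρ x).1) x₀ e) =
        ∑ i, h i (ψ e) • Y i (F e)) ∧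
      (∀ᶠ e in 𝓝 e₀, covectorRep (fun x => (ρ x).2) x₀ e =
        (∑ i, h i (ψ e) • η i (F e)).comp (fderiv ℝ F e)) := by
    intro ρ h hρ
    constructor
    · refine hnear fun x hxU hx hfx => ?_
      rw [vectorRep_extChartAt _ hx, hF, fderiv_chartRep_toModel hf hx hfx, (hρ x hxU).1,
        chartRep_extChartAt f hx, hY0 hfx, hψ,
        (extChartAt 𝓘(ℝ, E') x₀).left_inv (by rwa [extChartAt_source]), Prod.fst_sum]
      rfl
    · refine hnear fun x hxU hx hfx => ?_
      rw [covectorRep_extChartAt _ hx, (hρ x hxU).2.1, covectorToModel_comp_pushforward hf hx hfx,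
        hF, chartRep_extChartAt f hx, hη0 hfx, hψ,
        (extChartAt 𝓘(ℝ, E') x₀).left_inv (by rwa [extChartAt_source]), Prod.snd_sum]
      rfl
  have hgd : ∀ {h : B → ℝ}, ContMDiffOn 𝓘(ℝ, E') 𝓘(ℝ, ℝ) ∞ h U →
      DifferentiableAt ℝ (fun e => h (ψ e)) e₀ := fun hh =>
    (contDiffAt_comp_extChartAt_symm hU hx₀ hh).differentiableAt (by simp)
  have hYd : ∀ i, DifferentiableAt ℝ (Y i) (F e₀) := fun i => by
    rw [hFe₀]
    exact (contDiffAt_vectorRep isOpen_univ (Set.mem_univ _) (ha i).1.1).differentiableAt (by simp)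
  have hηd : ∀ i, DifferentiableAt ℝ (η i) (F e₀) := fun i => by
    rw [hFe₀]
    exact (contDiffAt_covectorRep isOpen_univ (Set.mem_univ _) (ha i).1.2).differentiableAt
      (by simp)
  have hXd : ∀ {ρ : ∀ x : B, GenTan E' x}, SmoothGenSectionOn ρ Set.univ →
      DifferentiableAt ℝ (vectorRep (fun x => (ρ x).1) x₀) e₀ := fun hρ =>
    (contDiffAt_vectorRep isOpen_univ (Set.mem_univ _) hρ.1).differentiableAt (by simp)
  rw [pairing_courantBracket isOpen_univ (Set.mem_univ _) hσ.1 hτ.1,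
    covectorToModel_comp_pushforward hf hx hfx β]
  refine (courantForm_pullback (F := F) (Y := Y) (η := η)
    (w := toModel (f x₀) (f x₀) (pushforward f x₀ v))
    ((contDiffAt_chartRep hf x₀).of_le ENat.LEInfty.out) (hXd hσ.1) (hXd hτ.1)
    (fun i => hgd (hg i)) (fun i => hgd (hg' i)) hYd hηd (hrel hgσ).1 (hrel hgτ).1 (hrel hgσ).2
    (hrel hgτ).2 (fderiv_chartRep_toModel hf hx hfx v) ?_ ?_).trans ?_
  · intro p
    rw [hFe₀, hY0 hfx, hη0 hfx]
    exact hpair _ _ hβ (hamem p _)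
  · intro p q
    rw [hFe₀, hY0 hfx, hη0 hfx, hY0 hfx, hη0 hfx]
    exact hpair _ _ (hamem p _) (hamem q _)
  · rw [hψe₀, hY, hη, hY, hη, hFe₀]
    have h := pairing_courantBracket isOpen_univ (Set.mem_univ _)
      (hsec fun i => g i x₀).1 (hsec fun i => g' i x₀).1
      ((pushforward f x₀ v, β) : GenTan E (f x₀))
    refine h.symm.trans ?_
    exact (hL.maximal_isotropic (f x₀)).prop _ (hL.involutive _ _ (hsec _) (hsec _) _) _ hβ

end Involutive

/-! ### The singular foliation of a Dirac structure -/

section Foliation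

open Filter Topology

variable {E : Type*} [NormedAddCommGroup E] [NormedSpace ℝ E] [FiniteDimensional ℝ E]
  {M : Type*} [TopologicalSpace M] [T2Space M] [SecondCountableTopology M]
  [ChartedSpace E M] [IsManifold 𝓘(ℝ, E) ∞ M]

/-- The compactly supported sections of a Dirac structure induce a singular foliation. The anchor
images of a local frame generate it, and it is involutive because the vector component of the
Courant bracket is the Lie bracket. -/
theorem IsDirac.isSingularFoliation {D : ∀ x : M, Submodule ℝ (GenTan E x)} (hD : IsDirac D) :
    IsSingularFoliation (diracFoliation D) where
  smooth := by
    rintro X ⟨σ, hσ, -, hX⟩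
    obtain rfl : X = fun x => (σ x).1 := funext hX
    exact hσ.1.1
  compact_support := by
    rintro X ⟨σ, -, hc, hX⟩
    refine hc.closure_of_subset fun x hx => subset_closure fun h => hx ?_
    rw [hX, h]
    rfl
  zero_mem := by
    refine ⟨fun x => 0, ⟨?_, fun x => (D x).zero_mem⟩, by simp, fun x => rfl⟩
    exact (SmoothGenSectionOn.sum_smul (n := 0) (s := fun _ _ => 0) (c := fun _ _ => 0)
      (fun k => k.elim0) (fun k => k.elim0)).congr fun x _ => by simp
  add_mem := by
    rintro X ⟨σ, hσ, hσc, hX⟩ Y ⟨τ, hτ, hτc, hY⟩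
    refine ⟨fun x => σ x + τ x, ⟨⟨ContMDiffOn.add_section hσ.1.1 hτ.1.1,
      ContMDiffOn.add_section hσ.1.2 hτ.1.2⟩, fun x => (D x).add_mem (hσ.2 x) (hτ.2 x)⟩,
      (hσc.union hτc).closure_of_subset fun x hx => ?_, fun x => congrArg₂ (· + ·) (hX x) (hY x)⟩
    by_cases h : σ x = 0
    · refine Or.inr (subset_closure fun h' => hx ?_)
      change σ x + τ x = 0
      rw [h, h', add_zero]
    · exact Or.inl (subset_closure h)
  smul_mem := by
    rintro h hh X ⟨σ, hσ, hσc, hX⟩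
    refine ⟨fun x => h x • σ x, ⟨⟨ContMDiffOn.smul_section hh.contMDiffOn hσ.1.1,
      ContMDiffOn.smul_section hh.contMDiffOn hσ.1.2⟩, fun x => (D x).smul_mem _ (hσ.2 x)⟩,
      hσc.closure_of_subset fun x hx => subset_closure fun h' => hx ?_,
      fun x => congrArg (h x • ·) (hX x)⟩
    change h x • σ x = 0
    rw [h', smul_zero]
  locally_finitely_generated := by
    intro x₀
    obtain ⟨U, hU, hx₀, r, s, hs, hspan⟩ := hD.smooth x₀
    refine ⟨U, hU, hx₀, r, fun i x => (s i x).1, fun i => (hs i).1, fun X => ⟨?_, ?_⟩⟩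
    · rintro ⟨⟨σ, hσ, hσc, hX⟩, hXU⟩
      have hXc : IsCompact (closure {x | X x ≠ 0}) :=
        hσc.closure_of_subset fun x hx => subset_closure fun h => hx <| by rw [hX, h]; rfl
      obtain ⟨ρ, hρ, hρc, hρU, hρ1⟩ := exists_contMDiff_bump (E := E) hXc hU hXU
      have hex : ∀ x, ∃ c : Fin r → ℝ, x ∈ U → ∑ k, c k • s k x = σ x := by
        intro x
        by_cases hx : x ∈ U
        · have h := hσ.2 x
          rw [← (hspan x hx).2, Submodule.mem_span_range_iff_exists_fun] at h
          obtain ⟨c, hc⟩ := h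
          exact ⟨c, fun _ => hc⟩
        · exact ⟨0, fun h => absurd h hx⟩
      choose c hc using hex
      have hcs : ∀ k, ContMDiffOn 𝓘(ℝ, E) 𝓘(ℝ, ℝ) ∞ (fun x => c x k) U :=
        contMDiffOn_coeff hU hs (fun x hx => (hspan x hx).1)
          ((hσ.1.mono (Set.subset_univ U)).congr hc)
      -- The coefficients `c` are cut off by `ρ`, which is `1` on the support of `X`. The section
      -- `σ` itself need not have its support in `U`.
      have hsub : ∀ i, tsupport (fun x => ρ x * c x i) ⊆ tsupport ρ := fun i =>
        tsupport_mul_subset_left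
      refine ⟨fun i x => ρ x * c x i, fun i => ⟨?_, hρc.mul_right, (hsub i).trans hρU⟩,
        fun x => ?_⟩
      · refine contMDiff_of_tsupport fun x hx => ?_
        exact hρ.contMDiffAt.mul ((hcs i).contMDiffAt (hU.mem_nhds (hρU (hsub i hx))))
      · have hρX : X x = ρ x • X x := by
          by_cases h : X x = 0
          · rw [h, smul_zero]
          · rw [hρ1.self_of_nhdsSet x (subset_closure h), one_smul]
        rw [hρX]
        by_cases hx : x ∈ U
        · rw [hX, ← hc x hx, Prod.fst_sum, Finset.smul_sum]
          simp only [Prod.smul_fst, mul_smul]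
        · have h0 : ρ x = 0 := image_eq_zero_of_notMem_tsupport fun h => hx (hρU h)
          simp [h0]
    · rintro ⟨h, hh, hX⟩
      have hK : ∀ x, x ∉ ⋃ i, tsupport (h i) → ∀ i, h i x = 0 := fun x hx i =>
        image_eq_zero_of_notMem_tsupport fun hx' => hx (Set.mem_iUnion.2 ⟨i, hx'⟩)
      have hKc : IsCompact (⋃ i, tsupport (h i)) := isCompact_iUnion fun i => (hh i).2.1
      refine ⟨⟨fun x => ∑ i, h i x • s i x, ⟨?_, fun x => ?_⟩,
        hKc.closure_of_subset fun x hx => ?_, fun x => ?_⟩, ?_⟩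
      · refine (SmoothGenSectionOn.sum_smul (c := fun _ _ => 1)
          (fun i => (hs i).smul_of_tsupport hU (hh i).1 (hh i).2.2)
          fun i => contMDiffOn_const).congr fun x _ => ?_
        simp only [one_smul]
      · refine Submodule.sum_mem _ fun i _ => ?_
        by_cases hx : x ∈ U
        · rw [← (hspan x hx).2]
          exact Submodule.smul_mem _ _ (Submodule.subset_span ⟨i, rfl⟩)
        · rw [image_eq_zero_of_notMem_tsupport fun h' => hx ((hh i).2.2 h'), zero_smul]
          exact (D x).zero_mem
      · by_contra hx'
        exact hx (Finset.sum_eq_zero fun i _ => by rw [hK x hx' i, zero_smul])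
      · rw [hX, Prod.fst_sum]
        rfl
      · refine (closure_minimal (fun x hx => ?_) hKc.isClosed).trans
          (Set.iUnion_subset fun i => (hh i).2.2)
        by_contra hx'
        refine hx ?_
        rw [hX]
        exact Finset.sum_eq_zero fun i _ => by rw [hK x hx' i, zero_smul]
  involutive := by
    rintro X ⟨σ, hσ, hσc, hX⟩ Y ⟨τ, hτ, -, hY⟩
    obtain rfl : X = fun x => (σ x).1 := funext hX
    obtain rfl : Y = fun x => (τ x).1 := funext hY
    obtain ⟨ρ, hρ, hρc, -, hρ1⟩ := exists_contMDiff_bump (E := E) hσc isOpen_univ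
      (Set.subset_univ _)
    -- The cut-off by `ρ` makes the compact support of the bracket evident, and does not change its
    -- vector component, which is supported where `σ` is.
    refine ⟨fun x => ρ x • courantBracket σ τ x, ⟨(smoothGenSectionOn_courantBracket hσ.1
      hτ.1).smul_of_tsupport isOpen_univ hρ (Set.subset_univ _), fun x =>
      (D x).smul_mem _ (hD.involutive σ τ hσ hτ x)⟩, hρc.isCompact.closure_of_subset fun x hx => ?_,
      fun x => ?_⟩
    · by_contra hx'
      refine hx ?_
      change ρ x • courantBracket σ τ x = 0
      rw [image_eq_zero_of_notMem_tsupport hx', zero_smul]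
    · by_cases hx : x ∈ closure {x | σ x ≠ 0}
      · change _ = ρ x • VectorField.mlieBracket 𝓘(ℝ, E) (fun y => (σ y).1) (fun y => (τ y).1) x
        rw [hρ1.self_of_nhdsSet x hx, one_smul]
      · have h0 : (fun y => (σ y).1) =ᶠ[𝓝 x] 0 := by
          filter_upwards [isClosed_closure.isOpen_compl.mem_nhds hx] with y hy
          have : σ y = 0 := by_contra fun h => hy (subset_closure h)
          rw [this]
          rfl
        have h1 : VectorField.mlieBracket 𝓘(ℝ, E) (fun y => (σ y).1) (fun y => (τ y).1) x = 0 := by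
          refine (h0.mlieBracket_vectorField_eq EventuallyEq.rfl).trans ?_
          exact congrFun VectorField.mlieBracket_zero_left x
        change VectorField.mlieBracket 𝓘(ℝ, E) (fun y => (σ y).1) (fun y => (τ y).1) x =
          ρ x • VectorField.mlieBracket 𝓘(ℝ, E) (fun y => (σ y).1) (fun y => (τ y).1) x
        rw [h1, smul_zero]

end Foliation

/-! ### Comparison of `𝔅L` with `f^! L` -/

section Comparison

open Filter Topology

variable {E : Type*} [NormedAddCommGroup E] [NormedSpace ℝ E]
  {M : Type*} [TopologicalSpace M] [ChartedSpace E M] [IsManifold 𝓘(ℝ, E) ∞ M]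
  {E' : Type*} [NormedAddCommGroup E'] [NormedSpace ℝ E'] {B : Type*} [TopologicalSpace B]
  [ChartedSpace E' B]

theorem isDirac_diracPullback [FiniteDimensional ℝ E] [T2Space M] [SecondCountableTopology M]
    [FiniteDimensional ℝ E'] [IsManifold 𝓘(ℝ, E') ∞ B] {f : B → M}
    (hf : ContMDiff 𝓘(ℝ, E') 𝓘(ℝ, E) ∞ f)
    {L : ∀ y : M, Submodule ℝ (GenTan E y)} (hL : IsDirac L)
    (hsmooth : AlgebroidPullbackSmooth (E' := E') f L) :
    IsDirac (diracPullback (E' := E') f L) where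
  smooth := by
    intro x₀
    obtain ⟨W, hW, hx₀W, r, a, ha, haL⟩ := hL.smooth.exists_global_frame (f x₀)
    obtain ⟨U, hU, hx₀, -, n, s, G, hs, -, h⟩ := exists_local_frame hf hL.maximal_isotropic hsmooth
      x₀ hW hx₀W (fun i => (ha i).1) haL
    exact ⟨U, hU, hx₀, n, s, hs, fun x hx => (h x hx).2⟩
  maximal_isotropic := maximal_isIsotropic_diracPullback f hL.maximal_isotropic
  involutive _ _ hσ hτ := courantBracket_mem_diracPullback hf hL hsmooth hσ hτ

/-- The projection `(a, X) ↦ (X, f^* pr_{T*M}(a))` maps sections of `f^! L` to sections of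
`𝔅L`. -/
theorem algebroidPullbackFoliation_subset [FiniteDimensional ℝ E'] [T2Space B]
    [IsManifold 𝓘(ℝ, E') ∞ B] {f : B → M}
    (hf : ContMDiff 𝓘(ℝ, E') 𝓘(ℝ, E) ∞ f) (L : ∀ y : M, Submodule ℝ (GenTan E y)) :
    algebroidPullbackFoliation (E' := E') f L ⊆ diracFoliation (diracPullback (E' := E') f L) := by
  rintro X ⟨σ, ⟨-, hσ2, hσ3, hσL⟩, hσc, hX⟩
  refine ⟨fun x => ((σ x).2, (σ x).1.2.comp (pushforward f x)), ⟨⟨hσ3, ?_⟩, fun x => ?_⟩,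
    hσc.closure_of_subset fun x hx => subset_closure fun h => hx ?_, hX⟩
  · intro x₀ _
    set U := (chartAt E' x₀).source ∩ f ⁻¹' (chartAt E (f x₀)).source with hUdef
    have hU : IsOpen U := (chartAt E' x₀).open_source.inter
      ((chartAt E (f x₀)).open_source.preimage hf.continuous)
    have hx₀ : x₀ ∈ U := ⟨mem_chart_source E' x₀, mem_chart_source E (f x₀)⟩
    refine ContMDiffAt.contMDiffWithinAt (ContMDiffOn.contMDiffAt (s := U) ?_ (hU.mem_nhds hx₀))
    refine (contMDiffOn_covector_iff (f := id) (y₀ := x₀) (fun x hx => hx.1)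
      fun x => (σ x).1.2.comp (pushforward f x)).2 ⟨contMDiffOn_id, ?_⟩
    have h1 := ((contMDiffOn_covector_iff (U := U) (y₀ := f x₀) (fun x hx => hx.2) _).1
      hσ2.contMDiffOn).2
    have h2 := contMDiffOn_pushforward_coord hf (x₀ := x₀) (y₀ := f x₀) (U := U)
      (fun x hx => hx.1) (fun x hx => hx.2)
    refine (h1.clm_comp h2).congr fun x hx => ?_
    ext v
    exact congrArg (σ x).1.2 (ofModel_toModel hx.2 _).symm
  · exact ⟨(σ x).1.2, by rw [← (hσL x).2]; exact (hσL x).1, rfl⟩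
  · beta_reduce
    rw [h]
    refine Prod.ext rfl ?_
    ext v
    rfl

/-- Smoothness on `U` of a section of `f^*(TM ⊕ T^*M)`, that is of its two components as maps to
the total spaces that cover `f`. -/
def SmoothGenSectionAlongOn (f : B → M) (α : ∀ x : B, GenTan E (f x)) (U : Set B) : Prop :=
  ContMDiffOn 𝓘(ℝ, E') (𝓘(ℝ, E).prod 𝓘(ℝ, E)) ∞
      (fun x => (⟨f x, (α x).1⟩ : TangentBundle 𝓘(ℝ, E) M)) U ∧
    ContMDiffOn 𝓘(ℝ, E') (𝓘(ℝ, E).prod 𝓘(ℝ, E →L[ℝ] ℝ)) ∞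
      (fun x => (⟨f x, (α x).2⟩ :
        Bundle.TotalSpace (E →L[ℝ] ℝ) (fun y : M => Cotan E y))) U

theorem smoothGenSectionAlongOn_iff {f : B → M} (hf : ContMDiff 𝓘(ℝ, E') 𝓘(ℝ, E) ∞ f) {U : Set B}
    {y₀ : M} (hU : Set.MapsTo f U (chartAt E y₀).source) (α : ∀ x : B, GenTan E (f x)) :
    SmoothGenSectionAlongOn (E' := E') f α U ↔
      ContMDiffOn 𝓘(ℝ, E') 𝓘(ℝ, E × (E →L[ℝ] ℝ)) ∞
        (fun x => (toModel y₀ (f x) (α x).1, covectorToModel y₀ (f x) (α x).2)) U := by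
  refine (and_congr (contMDiffOn_vector_iff hU fun x => (α x).1)
    (contMDiffOn_covector_iff hU fun x => (α x).2)).trans
    ⟨fun h => h.1.2.prodMk_space h.2.2, fun h => ?_⟩
  exact ⟨⟨hf.contMDiffOn, (ContinuousLinearMap.fst ℝ E (E →L[ℝ] ℝ)).contMDiff.comp_contMDiffOn h⟩,
    ⟨hf.contMDiffOn, (ContinuousLinearMap.snd ℝ E (E →L[ℝ] ℝ)).contMDiff.comp_contMDiffOn h⟩⟩

/-- Local smooth sections along `f`, glued by a partition of unity, form a smooth section. -/
theorem smoothGenSectionAlongOn_finsum {f : B → M} (hf : ContMDiff 𝓘(ℝ, E') 𝓘(ℝ, E) ∞ f)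
    {ι : Type*} {U : ι → Set B} (hUo : ∀ p, IsOpen (U p))
    (ρ : SmoothPartitionOfUnity ι 𝓘(ℝ, E') B Set.univ) (hρ : ρ.IsSubordinate U)
    {α : ι → ∀ x : B, GenTan E (f x)}
    (hα : ∀ p, SmoothGenSectionAlongOn (E' := E') f (α p) (U p)) :
    SmoothGenSectionAlongOn (E' := E') f (fun x => ∑ᶠ p, ρ p x • α p x) Set.univ := by
  have key : ∀ x₀ : B, ∃ V, IsOpen V ∧ x₀ ∈ V ∧
      SmoothGenSectionAlongOn (E' := E') f (fun x => ∑ᶠ p, ρ p x • α p x) V := by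
    intro x₀
    refine ⟨f ⁻¹' (chartAt E (f x₀)).source, (chartAt E (f x₀)).open_source.preimage hf.continuous,
      mem_chart_source E (f x₀), ?_⟩
    have hVo := (chartAt E (f x₀)).open_source.preimage hf.continuous
    refine (smoothGenSectionAlongOn_iff hf (y₀ := f x₀) (fun x hx => hx) _).2 ?_
    have h1 : ContMDiffOn 𝓘(ℝ, E') 𝓘(ℝ, E × (E →L[ℝ] ℝ)) ∞
        (fun x => ∑ᶠ p, ρ p x • ((toModel (f x₀) (f x) (α p x).1,
          covectorToModel (f x₀) (f x) (α p x).2) : E × (E →L[ℝ] ℝ)))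
        (f ⁻¹' (chartAt E (f x₀)).source) := by
      intro x hx
      refine (ρ.contMDiffAt_finsum fun p hp => ?_).contMDiffWithinAt
      have hx' : x ∈ U p ∩ f ⁻¹' (chartAt E (f x₀)).source := ⟨hρ p hp, hx⟩
      refine ((smoothGenSectionAlongOn_iff hf (y₀ := f x₀) (fun x hx => hx.2) _).1
        ⟨(hα p).1.mono Set.inter_subset_left, (hα p).2.mono Set.inter_subset_left⟩).contMDiffAt
        (((hUo p).inter hVo).mem_nhds hx')
    refine h1.congr fun x hx => ?_
    refine ((genToModel (x₀ := f x₀) hx).toAddEquiv.map_finsum _).trans (finsum_congr fun p => ?_)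
    exact (genToModel (x₀ := f x₀) hx).map_smul _ _
  constructor
  · intro x _
    obtain ⟨V, hV, hx, h⟩ := key x
    exact (h.1.contMDiffAt (hV.mem_nhds hx)).contMDiffWithinAt
  · intro x _
    obtain ⟨V, hV, hx, h⟩ := key x
    exact (h.2.contMDiffAt (hV.mem_nhds hx)).contMDiffWithinAt

/-- Compactly supported sections of `𝔅L` lift to compactly supported sections of `f^! L`, by a
partition of unity. -/
theorem diracFoliation_subset [T2Space M] [SecondCountableTopology M] [T2Space B]
    [SecondCountableTopology B] [FiniteDimensional ℝ E] [FiniteDimensional ℝ E']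
    [IsManifold 𝓘(ℝ, E') ∞ B]
    {f : B → M} (hf : ContMDiff 𝓘(ℝ, E') 𝓘(ℝ, E) ∞ f) {L : ∀ y : M, Submodule ℝ (GenTan E y)}
    (hL : IsDirac L) (hsmooth : AlgebroidPullbackSmooth (E' := E') f L) :
    diracFoliation (diracPullback (E' := E') f L) ⊆ algebroidPullbackFoliation (E' := E') f L := by
  rintro X ⟨σ, ⟨hσ, hσL⟩, hσc, hX⟩
  -- `S x` holds the possible values at `x` of a lift that vanishes with `σ`. It is convex, so local
  -- lifts can be glued.
  let S : ∀ x : B, Set (GenTan E (f x)) := fun x =>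
    {β | β ∈ L (f x) ∧ β.1 = pushforward f x (σ x).1 ∧ (σ x = 0 → β = 0)}
  have hloc : ∀ p : B, ∃ U : Set B, IsOpen U ∧ p ∈ U ∧ ∃ α : ∀ x : B, GenTan E (f x),
      SmoothGenSectionAlongOn (E' := E') f α U ∧ ∀ x ∈ U, α x ∈ S x := by
    intro p
    obtain ⟨W, hW, hpW, r, a, ha, haL⟩ := hL.smooth.exists_global_frame (f p)
    obtain ⟨U, hU, hpU, hlift⟩ := exists_local_lift hf hL.maximal_isotropic hsmooth p hW hpW
      (fun i => (ha i).1) haL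
    obtain ⟨g, hg, h⟩ := hlift σ (hσ.mono (Set.subset_univ U)) hσL
    refine ⟨U ∩ f ⁻¹' (chartAt E (f p)).source,
      hU.inter ((chartAt E (f p)).open_source.preimage hf.continuous),
      ⟨hpU, mem_chart_source E (f p)⟩, fun x => ∑ i, g i x • a i (f x), ?_,
      fun x hx => ⟨?_, ?_, ?_⟩⟩
    · refine (smoothGenSectionAlongOn_iff hf (y₀ := f p) (fun x hx => hx.2) _).2 ?_
      have h1 : ∀ i, ContMDiffOn 𝓘(ℝ, E') 𝓘(ℝ, E × (E →L[ℝ] ℝ)) ∞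
          (fun x => (toModel (f p) (f x) (a i (f x)).1, covectorToModel (f p) (f x) (a i (f x)).2))
          (U ∩ f ⁻¹' (chartAt E (f p)).source) := fun i =>
        ((smoothGenSectionOn_iff (x₀ := f p) subset_rfl (a i)).1
          ((ha i).1.mono (Set.subset_univ _))).comp hf.contMDiffOn fun x hx => hx.2
      refine (contMDiffOn_finsetSum (t := Finset.univ) fun i _ =>
        ((hg i).mono Set.inter_subset_left).smul (h1 i)).congr fun x hx => ?_
      refine (map_sum (genToModel (x₀ := f p) hx.2) _ _).trans (Finset.sum_congr rfl fun i _ => ?_)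
      exact (genToModel (x₀ := f p) hx.2).map_smul _ _
    · exact Submodule.sum_mem _ fun i _ => Submodule.smul_mem _ _ ((ha i).2 (f x))
    · rw [(h x hx.1).1, Prod.fst_sum]
      rfl
    · intro h0
      exact Finset.sum_eq_zero fun i _ => by rw [(h x hx.1).2.2 h0 i, zero_smul]
  choose U hUo hpU α hα hαS using hloc
  have : LocallyCompactSpace B := ChartedSpace.locallyCompactSpace E' B
  obtain ⟨ρ, hρ⟩ := SmoothPartitionOfUnity.exists_isSubordinate 𝓘(ℝ, E') isClosed_univ U hUo
    fun p _ => Set.mem_iUnion.2 ⟨p, hpU p⟩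
  have hconv : ∀ x, Convex ℝ (S x) := by
    intro x β hβ γ hγ s t _ _ hst
    refine ⟨(L (f x)).add_mem ((L (f x)).smul_mem s hβ.1) ((L (f x)).smul_mem t hγ.1), ?_, ?_⟩
    · change s • β.1 + t • γ.1 = _
      rw [hβ.2.1, hγ.2.1, ← add_smul, hst, one_smul]
    · intro h
      rw [hβ.2.2 h, hγ.2.2 h, smul_zero, smul_zero, add_zero]
  have hS : ∀ x, ∑ᶠ p, ρ p x • α p x ∈ S x := fun x =>
    (hconv x).finsum_mem (fun p => ρ.nonneg p x) (ρ.sum_eq_one (Set.mem_univ x))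
      fun p hp => hαS p x (hρ p (subset_tsupport _ hp))
  have hA := smoothGenSectionAlongOn_finsum hf hUo ρ hρ hα
  refine ⟨fun x => (∑ᶠ p, ρ p x • α p x, (σ x).1),
    ⟨contMDiffOn_univ.1 hA.1, contMDiffOn_univ.1 hA.2,
    hσ.1, fun x => ⟨(hS x).1, (hS x).2.1⟩⟩,
    hσc.closure_of_subset fun x hx => subset_closure fun h => hx ?_, hX⟩
  exact Prod.ext ((hS x).2.2 h) (congrArg Prod.fst h)

end Comparison

end DiracPullback

end

theorem proposition4p3
    {E : Type*} [NormedAddCommGroup E] [NormedSpace ℝ E] [FiniteDimensional ℝ E]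
    {M : Type*} [TopologicalSpace M] [T2Space M] [SecondCountableTopology M]
    [ChartedSpace E M] [IsManifold 𝓘(ℝ, E) ∞ M]
    {E' : Type*} [NormedAddCommGroup E'] [NormedSpace ℝ E'] [FiniteDimensional ℝ E']
    {B : Type*} [TopologicalSpace B] [T2Space B] [SecondCountableTopology B]
    [ChartedSpace E' B] [IsManifold 𝓘(ℝ, E') ∞ B]
    (f : B → M) (hf : ContMDiff 𝓘(ℝ, E') 𝓘(ℝ, E) ∞ f)
    (L : ∀ y : M, Submodule ℝ (DiracPullback.GenTan E y))
    (hL : DiracPullback.IsDirac L)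
    (hsmooth : DiracPullback.AlgebroidPullbackSmooth (E' := E') f L) :
    DiracPullback.IsDirac (DiracPullback.diracPullback (E' := E') f L) ∧
    DiracPullback.IsSingularFoliation
      (DiracPullback.diracFoliation (DiracPullback.diracPullback (E' := E') f L)) ∧
    DiracPullback.diracFoliation (DiracPullback.diracPullback (E' := E') f L) =
      DiracPullback.algebroidPullbackFoliation (E' := E') f L := by
  have hD := DiracPullback.isDirac_diracPullback hf hL hsmooth
  exact ⟨hD, hD.isSingularFoliation,
    (DiracPullback.diracFoliation_subset hf hL hsmooth).antisymm
      (DiracPullback.algebroidPullbackFoliation_subset hf L)⟩
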